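/- Let $\mathbb{T}=\mathbb{R}/\mathbb{Z}$, let $D=\mathbb{T}$ or $D=(0,1)$, and put $\Omega=\mathbb{T}\times D$. Let $b\in C^\infty(\bar D)$ have finitely many critical points $y_1,\dots,y_M$ in $\bar D$ ($M\ge 0$), such that for each $i$ there is $N_i\in\mathbb{N}$ with $b^{(k)}(y_i)=0$ for $1\le k\le N_i$ and $b^{(N_i+1)}(y_i)\neq 0$. Let $N=\max_i N_i$, and $N=0$ if $M=0$. Then there exist $d_0,\nu_0>0$ depending only on $b$ (and its domain $D$) such that for every $p>\frac{N+3}{2}$ there is a constant $C$ depending only on $b$ (with its domain $D$) and $p$ with the following property. Let $\nu\in(0,\nu_0)$, and impose periodic conditions in $y$ if $D=\mathbb{T}$, or homogeneous Dirichlet or homogeneous Neumann conditions on $\{y=0,1\}$ if $D=(0,1)$. Let $f_{\rm in}\in C^\infty(\bar\Omega)$ be real-valued, satisfy the boundary conditions, and have vanishing $x$-averages, $\int_{\mathbb{T}}f_{\rm in}(x,y)\,dx=0$ for all $y$. Let $f\in C([0,\infty);L^2(\Omega))\cap C^\infty(\bar\Omega\times(0,\infty))$ be the solution of $$\partial_t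 f+b(y)\,\partial_x f-\nu\,\partial_{yy}f=0$$ with $f(\cdot,0)=f_{\rm in}$ and these boundary conditions. Then for every $t>0$ the function $f(\cdot,t)$ is Gevrey-$p$ regular in $x$, that is, $\|\exp(a|\partial_x|^{1/p})f(\cdot,t)\|_{L^2(\Omega)}<\infty$ for some $a>0$, and precisely $$\left\|\exp\!\left(d_0\,\nu^{\frac{N+1}{N+3}}\,|\partial_x|^{\frac1p}\,t\right)f(\cdot,t)\right\|_{L^2(\Omega)}\le C\,\|f_{\rm in}\|_{L^2(\Omega)}.$$ Here $|\partial_x|$ is the Fourier multiplier in $x$ with symbol $2\pi|k|$, $k\in\mathbb{Z}$, so that $\|\exp(a|\partial_x|^{1/p})g\|_{L^2(\Omega)}^2=\sum_{k\in\mathbb{Z}}\int_D e^{2a(2\pi|k|)^{1/p}}|\hat g(k,y)|^2\,dy$ with $\hat g(k,y)=\int_{\mathbb{T}}e^{-2\pi i kx}g(x,y)\,dx$. -/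

import Mathlib

open MeasureTheory Set Filter Topology
open scoped ENNReal NNReal ContDiff

noncomputable section

namespace ShearFlow

/-- The cross-section `D` of the channel `Ω = 𝕋 × D`: the torus `𝕋 = ℝ / ℤ` or the interval
`(0, 1)`. -/
inductive CrossSection
  | torus
  | interval

/-- The closure of `D`. Functions on the torus are 1-periodic functions on `ℝ`, so for the torus
this is all of `ℝ`. -/
def CrossSection.closed : CrossSection → Set ℝ
  | .torus => univ
  | .interval => Icc 0 1

/-- A set that contains each point of the closure of `D` exactly once. -/
def CrossSection.points : CrossSection → Set ℝ
  | .torus => Ico 0 1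
  | .interval => Icc 0 1

/-- `b ∈ C^∞(D̄)`; on the torus this includes 1-periodicity. -/
def SmoothProfile (D : CrossSection) (b : ℝ → ℝ) : Prop :=
  ContDiffOn ℝ ∞ b D.closed ∧ (D = .torus → Function.Periodic b 1)

/-- The critical points of `b` in the closure of `D`. -/
def criticalPoints (D : CrossSection) (b : ℝ → ℝ) : Set ℝ :=
  {y | y ∈ D.points ∧ derivWithin b D.closed y = 0}

/-- `n` is the order of vanishing of `b'` at `y`:
`b^{(k)}(y) = 0` for `1 ≤ k ≤ n` and `b^{(n+1)}(y) ≠ 0`. -/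
def VanishingOrder (D : CrossSection) (b : ℝ → ℝ) (y : ℝ) (n : ℕ) : Prop :=
  (∀ k : ℕ, 1 ≤ k → k ≤ n → iteratedDerivWithin k b D.closed y = 0) ∧
    iteratedDerivWithin (n + 1) b D.closed y ≠ 0

/-- `b` is a smooth shear profile on `D` with finitely many critical points, `b'` vanishes to
finite order at each of them, and `N` is the maximum of these orders (`N = 0` if there are no
critical points). -/
def IsShearProfile (D : CrossSection) (b : ℝ → ℝ) (N : ℕ) : Prop :=
  SmoothProfile D b ∧
    ∃ (h : (criticalPoints D b).Finite) (order : ℝ → ℕ),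
      (∀ y ∈ criticalPoints D b, VanishingOrder D b y (order y)) ∧
        N = h.toFinset.sup order

/-- The boundary conditions in `y`. -/
inductive BoundaryCondition
  | periodic
  | dirichlet
  | neumann

/-- The cross-section on which a boundary condition is posed. -/
def BoundaryCondition.crossSection : BoundaryCondition → CrossSection
  | .periodic => .torus
  | .dirichlet => .interval
  | .neumann => .interval

/-- The function `g(x, y)` satisfies the boundary condition in `y`. -/
def BoundaryCondition.Holds : BoundaryCondition → (ℝ × ℝ → ℝ) → Prop
  | .periodic, g => ∀ x y, g (x, y + 1) = g (x, y)
  | .dirichlet, g => ∀ x, g (x, 0) = 0 ∧ g (x, 1) = 0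
  | .neumann, g => ∀ x, derivWithin (fun y => g (x, y)) (Icc 0 1) 0 = 0 ∧
      derivWithin (fun y => g (x, y)) (Icc 0 1) 1 = 0

/-- The function `g(x, y)` is 1-periodic in `x` on `D̄`. -/
def PeriodicInX (D : CrossSection) (g : ℝ × ℝ → ℝ) : Prop :=
  ∀ x, ∀ y ∈ D.closed, g (x + 1, y) = g (x, y)

/-- The measure on (a fundamental domain of) `Ω`. -/
def volΩ : Measure (ℝ × ℝ) := volume.restrict (Ioo 0 1 ×ˢ Ioo 0 1)

/-- Admissible initial data: `f_in ∈ C^∞(Ω̄)` with the boundary condition, and with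
vanishing `x`-averages. -/
structure IsInitialDatum (bc : BoundaryCondition) (f_in : ℝ × ℝ → ℝ) : Prop where
  smooth : ContDiffOn ℝ ∞ f_in (univ ×ˢ bc.crossSection.closed)
  periodic_x : PeriodicInX bc.crossSection f_in
  boundary : bc.Holds f_in
  mean_zero : ∀ y ∈ bc.crossSection.closed, ∫ x in (0 : ℝ)..1, f_in (x, y) = 0

/-- `f ∈ C([0,∞); L²(Ω)) ∩ C^∞(Ω̄ × (0,∞))` solves `∂_t f + b(y) ∂_x f - ν ∂_yy f = 0` with initial
datum `f_in` and the given boundary condition; `f t (x, y)` is the value at time `t`. -/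
structure IsSolution (bc : BoundaryCondition) (b : ℝ → ℝ) (ν : ℝ) (f_in : ℝ × ℝ → ℝ)
    (f : ℝ → ℝ × ℝ → ℝ) : Prop where
  smooth : ContDiffOn ℝ ∞ (Function.uncurry f) (Ioi 0 ×ˢ (univ ×ˢ bc.crossSection.closed))
  continuous_L2 : ∀ t₀, 0 ≤ t₀ →
    Tendsto (fun t => eLpNorm (f t - f t₀) 2 volΩ) (𝓝[Ici 0] t₀) (𝓝 0)
  initial : ∀ x, ∀ y ∈ bc.crossSection.closed, f 0 (x, y) = f_in (x, y)
  periodic_x : ∀ t, 0 < t → PeriodicInX bc.crossSection (f t)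
  boundary : ∀ t, 0 < t → bc.Holds (f t)
  equation : ∀ t, 0 < t → ∀ x, ∀ y ∈ bc.crossSection.closed,
    deriv (fun s => f s (x, y)) t + b y * deriv (fun x' => f t (x', y)) x
      - ν * iteratedDerivWithin 2 (fun y' => f t (x, y')) bc.crossSection.closed y = 0

/-- The Fourier coefficient in `x`: `∫₀¹ exp(-2πikx) g(x, y) dx`. -/
def xFourier (g : ℝ × ℝ → ℝ) (k : ℤ) (y : ℝ) : ℂ :=
  fourierCoeffOn (zero_lt_one : (0 : ℝ) < 1) (fun x => (g (x, y) : ℂ)) k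

/-- `‖exp(a |∂_x|^{1/p}) g‖_{L²(Ω)} ∈ [0, ∞]`, where `|∂_x|` is the Fourier multiplier with symbol
`2π|k|`. The value is `∞` exactly when `exp(a |∂_x|^{1/p}) g` is not in `L²(Ω)`. -/
def gevreyNorm (a p : ℝ) (g : ℝ × ℝ → ℝ) : ℝ≥0∞ :=
  (∑' k : ℤ, ∫⁻ y in Ioo (0 : ℝ) 1,
    ‖(Real.exp (a * (2 * Real.pi * |(k : ℝ)|) ^ (1 / p)) : ℂ) * xFourier g k y‖ₑ ^ 2)
      ^ (1 / 2 : ℝ)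

/-- `g` is Gevrey-`p` regular in `x` (as measured in `L²(Ω)`). -/
def GevreyInX (p : ℝ) (g : ℝ × ℝ → ℝ) : Prop :=
  ∃ a : ℝ, 0 < a ∧ gevreyNorm a p g < ⊤

end ShearFlow

end

/-!
The Fourier mode `u(t, y)` of frequency `k` in `x` solves `∂_t u + i κ b u - ν ∂_y² u = 0` on
`[0, 1]` with `κ = 2πk`. Its energy `∫ |u|² dy` never increases, and for `k ≠ 0` it decays at the rate
`ν ^ ((N + 1) / (N + 3)) |κ| ^ (2 / (N + 3))`, uniformly in `k` and small `ν`. As `p > (N + 3) / 2`,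
this rate dominates the Gevrey weight, and summing over `k` with Parseval's identity gives the
theorem. No logarithm of `ν` or `k` is lost, so the rate constant does not depend on `p`.

The decay rests on a resolvent estimate and an elementary form of the Gearhart–Prüss theorem.

*Resolvent* (`Nondegenerate.resolvent_estimate`). Let `F = i (κ b + μ) u - ν u''` and choose `δ` with
`ν = |κ| δ ^ (N + 3)`. The finite order of vanishing of `b'` implies that on every cell of length
comparable to `δ` there is a subinterval of comparable length on which `|κ b + μ|` is at least of
order `|κ| δ ^ (N + 1)`, with a fixed sign (`IsShearProfile.exists_nondegenerate`). Testing against a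
bump in that subinterval times the conjugate of `u` controls `u` there without boundary terms, and a
Poincaré inequality spreads the bound over the cell at the cost of `ν ∫ |u'|²`, which the energy
identity bounds by `∫ |F| |u|`. The boundary condition enters only in the energy identity. Summing
over the cells gives `‖F‖ ≥ c |κ| δ ^ (N + 1) ‖u‖`.

*Decay* (`IsModeSolution.resolvent_in_time`, `IsModeSolution.modeEnergy_le_exp`). Let `Ψ` be this
resolvent bound and `χ` a cutoff that vanishes at the ends of a time interval of length `S`. The
Fourier coefficients in time of `χ u` solve the resolvent equation with right-hand side the
coefficients of `χ' u`, so Parseval's identity gives `Ψ² ∫ χ² ‖u‖² ≤ ∫ χ'² ‖u‖²`. Since the energy is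
nonincreasing, with `S = 6 / Ψ` it drops by a factor `e` over the interval.

The solution is only assumed continuous in `L²` at time `0`, so the argument starts at a time
`t₀ ≤ t / 2`, which then tends to `0`.
-/

namespace ShearFlow

open ComplexConjugate

/-! ### Parametric integrals and Fourier coefficients -/

/-- A parametric integral is continuous on `A` if the integrand is jointly continuous on
`A × [a, b]`; nothing is assumed outside that set. -/
theorem continuousOn_parametric_intervalIntegral {X E : Type*} [TopologicalSpace X]
    [FirstCountableTopology X] [NormedAddCommGroup E] [NormedSpace ℝ E] {A : Set X} {a b : ℝ}
    (hab : a ≤ b) {G : X → ℝ → E}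
    (hG : ContinuousOn (Function.uncurry G) (A ×ˢ Icc a b)) :
    ContinuousOn (fun p => ∫ s in a..b, G p s) A := by
  rw [continuousOn_iff_continuous_domRestrict]
  have h1 : Continuous (Function.uncurry fun (p : A) (s : ℝ) => G p (projIcc a b hab s)) := by
    have h2 : Continuous fun q : A × ℝ => ((q.1 : X), ((projIcc a b hab q.2 : Icc a b) : ℝ)) := by
      fun_prop
    exact hG.comp_continuous h2 fun q => ⟨q.1.2, (projIcc a b hab q.2).2⟩
  have h3 := intervalIntegral.continuous_parametric_intervalIntegral_of_continuous'
    (μ := volume) h1 a b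
  refine h3.congr fun p => ?_
  refine intervalIntegral.integral_congr fun s hs => ?_
  rw [uIcc_of_le hab] at hs
  simp [projIcc_of_mem hab hs]

theorem hasDerivAt_parametric_intervalIntegral {E : Type*} [NormedAddCommGroup E]
    [NormedSpace ℝ E] {J : Set ℝ} (hJ : IsOpen J) {a b : ℝ}
    (hab : a ≤ b) {G G' : ℝ → ℝ → E}
    (hG : ContinuousOn (Function.uncurry G) (J ×ˢ Icc a b))
    (hG' : ContinuousOn (Function.uncurry G') (J ×ˢ Icc a b))
    (hderiv : ∀ y ∈ J, ∀ s ∈ Icc a b, HasDerivAt (fun y => G y s) (G' y s) y)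
    {y : ℝ} (hy : y ∈ J) :
    HasDerivAt (fun y => ∫ s in a..b, G y s) (∫ s in a..b, G' y s) y := by
  obtain ⟨ε, hε, hball⟩ := Metric.nhds_basis_closedBall.mem_iff.1 (hJ.mem_nhds hy)
  have hK : IsCompact (Metric.closedBall y ε ×ˢ Icc a b) :=
    (isCompact_closedBall y ε).prod isCompact_Icc
  obtain ⟨M, hM⟩ := hK.exists_bound_of_continuousOn
    (hG'.mono (prod_mono hball subset_rfl))
  have hslice : ∀ {H : ℝ → ℝ → E}, ContinuousOn (Function.uncurry H) (J ×ˢ Icc a b) →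
      ∀ z ∈ J, ContinuousOn (H z) (Icc a b) := by
    intro H hH z hz
    exact hH.comp (f := fun s => (z, s)) (by fun_prop) fun s hs => ⟨hz, hs⟩
  have hI : ∀ {s}, s ∈ uIoc a b → s ∈ Icc a b := by
    intro s hs
    rw [uIoc_of_le hab] at hs
    exact Ioc_subset_Icc_self hs
  have hsub : uIoc a b ⊆ Icc a b := fun s hs => hI hs
  have hmeas : ∀ {H : ℝ → ℝ → E}, ContinuousOn (Function.uncurry H) (J ×ˢ Icc a b) →
      ∀ z ∈ J, AEStronglyMeasurable (H z) (volume.restrict (uIoc a b)) := by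
    intro H hH z hz
    exact ((hslice hH z hz).mono hsub).aestronglyMeasurable measurableSet_uIoc
  refine (intervalIntegral.hasDerivAt_integral_of_dominated_loc_of_deriv_le
    (bound := fun _ => M) (Metric.closedBall_mem_nhds y hε) ?_ ?_ (hmeas hG' y hy) ?_ ?_ ?_).2
  · filter_upwards [hJ.mem_nhds hy] with z hz using hmeas hG z hz
  · exact ContinuousOn.intervalIntegrable (by rw [uIcc_of_le hab]; exact hslice hG y hy)
  · exact ae_of_all _ fun s hs z hz => hM (z, s) ⟨hz, hI hs⟩
  · exact intervalIntegrable_const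
  · exact ae_of_all _ fun s hs z hz => hderiv z (hball hz) s (hI hs)

theorem intervalIntegral_swap_of_continuousOn {a b c d : ℝ} (hab : a ≤ b) (hcd : c ≤ d)
    {G : ℝ → ℝ → ℝ} (hG : ContinuousOn (Function.uncurry G) (Icc a b ×ˢ Icc c d)) :
    ∫ x in a..b, ∫ y in c..d, G x y = ∫ y in c..d, ∫ x in a..b, G x y := by
  simp only [intervalIntegral.integral_of_le hab, intervalIntegral.integral_of_le hcd]
  refine integral_integral_swap ?_
  rw [Measure.prod_restrict]
  exact (hG.integrableOn_compact (isCompact_Icc.prod isCompact_Icc)).mono_set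
    (prod_mono Ioc_subset_Icc_self Ioc_subset_Icc_self)

theorem continuous_fourier_coe (T : ℝ) (m : ℤ) :
    Continuous fun s : ℝ => fourier m (s : AddCircle T) :=
  (map_continuous (fourier m)).comp continuous_quotient_mk'

theorem continuousOn_fourierCoeffOn {X : Type*} [TopologicalSpace X] [FirstCountableTopology X]
    {A : Set X} {a b : ℝ} (hab : a < b) {G : X → ℝ → ℂ}
    (hG : ContinuousOn (Function.uncurry G) (A ×ˢ Icc a b)) (m : ℤ) :
    ContinuousOn (fun p => fourierCoeffOn hab (G p) m) A := by
  simp only [fourierCoeffOn_eq_integral]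
  refine ContinuousOn.const_smul (continuousOn_parametric_intervalIntegral hab.le ?_) _
  have h : Continuous fun q : X × ℝ => fourier (-m) (q.2 : AddCircle (b - a)) :=
    (continuous_fourier_coe _ _).comp continuous_snd
  exact h.continuousOn.smul hG

theorem hasDerivAt_fourierCoeffOn {J : Set ℝ} (hJ : IsOpen J) {a b : ℝ} (hab : a < b)
    {G G' : ℝ → ℝ → ℂ} (hG : ContinuousOn (Function.uncurry G) (J ×ˢ Icc a b))
    (hG' : ContinuousOn (Function.uncurry G') (J ×ˢ Icc a b))
    (hderiv : ∀ y ∈ J, ∀ s ∈ Icc a b, HasDerivAt (fun y => G y s) (G' y s) y)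
    (m : ℤ) {y : ℝ} (hy : y ∈ J) :
    HasDerivAt (fun y => fourierCoeffOn hab (G y) m) (fourierCoeffOn hab (G' y) m) y := by
  have h : ContinuousOn (fun q : ℝ × ℝ => fourier (-m) (q.2 : AddCircle (b - a)))
      (J ×ˢ Icc a b) := ((continuous_fourier_coe _ _).comp continuous_snd).continuousOn
  simp only [fourierCoeffOn_eq_integral]
  exact (hasDerivAt_parametric_intervalIntegral
    (G := fun y s => fourier (-m) (s : AddCircle (b - a)) • G y s)
    (G' := fun y s => fourier (-m) (s : AddCircle (b - a)) • G' y s) hJ hab.le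
    (h.smul hG) (h.smul hG')
    (fun z hz s hs => (hderiv z hz s hs).fun_const_smul _) hy).const_smul _

theorem fourierCoeffOn_congr {a b : ℝ} (hab : a < b) {g₁ g₂ : ℝ → ℂ}
    (h : ∀ s ∈ Icc a b, g₁ s = g₂ s) (m : ℤ) :
    fourierCoeffOn hab g₁ m = fourierCoeffOn hab g₂ m := by
  refine congrFun (fourierCoeffOn_congr_ae hab ?_) m
  filter_upwards [ae_restrict_mem measurableSet_Ioc] with s hs using h s (Ioc_subset_Icc_self hs)

theorem fourierCoeffOn_add {a b : ℝ} (hab : a < b) {g₁ g₂ : ℝ → ℂ}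
    (h₁ : ContinuousOn g₁ (Icc a b)) (h₂ : ContinuousOn g₂ (Icc a b)) (m : ℤ) :
    fourierCoeffOn hab (fun s => g₁ s + g₂ s) m =
      fourierCoeffOn hab g₁ m + fourierCoeffOn hab g₂ m := by
  have hφ := (continuous_fourier_coe (b - a) (-m)).continuousOn (s := Icc a b)
  simp only [fourierCoeffOn_eq_integral, smul_add]
  rw [intervalIntegral.integral_add, smul_add]
  · exact ContinuousOn.intervalIntegrable (by rw [uIcc_of_le hab.le]; exact hφ.smul h₁)
  · exact ContinuousOn.intervalIntegrable (by rw [uIcc_of_le hab.le]; exact hφ.smul h₂)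

/-- Differentiation multiplies the Fourier coefficients on `[a, b]` by `2πim / (b - a)` when the end
values agree. -/
theorem fourierCoeffOn_deriv_of_eq {a b : ℝ} (hab : a < b) {g g' : ℝ → ℂ}
    (hg : ContinuousOn g (Icc a b)) (hg' : ContinuousOn g' (Icc a b))
    (hderiv : ∀ s ∈ Ioo a b, HasDerivAt g (g' s) s) (heq : g a = g b) (m : ℤ) :
    fourierCoeffOn hab g' m =
      Complex.I * (2 * Real.pi * m / (b - a) : ℝ) * fourierCoeffOn hab g m := by
  have hT : Fact (0 < b - a) := ⟨by linarith⟩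
  have hφ := (continuous_fourier_coe (b - a) (-m)).continuousOn (s := Icc a b)
  have hper : fourier (-m) (b : AddCircle (b - a)) = fourier (-m) (a : AddCircle (b - a)) := by
    congr 1
    have : (b : AddCircle (b - a)) = ((a + (b - a) : ℝ) : AddCircle (b - a)) := by
      congr 1; ring
    rw [this, AddCircle.coe_add_period]
  have hmm : min a b = a := min_eq_left hab.le
  have hMM : max a b = b := max_eq_right hab.le
  have key := intervalIntegral.integral_mul_deriv_eq_deriv_mul_of_hasDerivAt (a := a) (b := b)
    (u := fun s : ℝ => fourier (-m) (s : AddCircle (b - a))) (v := g) (v' := g')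
    (by rw [uIcc_of_le hab.le]; exact hφ) (by rw [uIcc_of_le hab.le]; exact hg)
    (fun s _ => hasDerivAt_fourier_neg (b - a) m s)
    (by rw [hmm, hMM]; exact hderiv)
    (ContinuousOn.intervalIntegrable (by rw [uIcc_of_le hab.le]; exact hφ.const_mul _))
    (ContinuousOn.intervalIntegrable (by rw [uIcc_of_le hab.le]; exact hg'))
  simp only [fourierCoeffOn_eq_integral, smul_eq_mul]
  rw [key]
  simp only [hper, heq, sub_self, zero_sub, mul_assoc, intervalIntegral.integral_const_mul,
    Complex.real_smul]
  push_cast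
  ring

theorem ofReal_integral_normSq {u : ℝ → ℂ} {a b : ℝ} (hab : a ≤ b)
    (hu : ContinuousOn u (Icc a b)) :
    ENNReal.ofReal (∫ y in a..b, ‖u y‖ ^ 2) = ∫⁻ y in Ioc a b, ‖u y‖ₑ ^ 2 := by
  rw [intervalIntegral.integral_of_le hab, ofReal_integral_eq_lintegral_ofReal]
  · refine lintegral_congr fun y => ?_
    rw [ENNReal.ofReal_pow (norm_nonneg _), ofReal_norm]
  · exact ((hu.norm.pow 2).integrableOn_compact isCompact_Icc).mono_set Ioc_subset_Icc_self
  · exact ae_of_all _ fun y => by positivity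

/-- Parseval's identity in the second variable, integrated over the first variable. -/
theorem tsum_integral_sq_fourierCoeffOn {a b : ℝ} (hab : a < b) {G : ℝ → ℝ → ℂ}
    (hG : ContinuousOn (Function.uncurry G) (Icc 0 1 ×ˢ Icc a b)) :
    ∑' m : ℤ, ENNReal.ofReal (∫ y in (0 : ℝ)..1, ‖fourierCoeffOn hab (G y) m‖ ^ 2) =
      ENNReal.ofReal ((b - a)⁻¹ * ∫ y in (0 : ℝ)..1, ∫ s in a..b, ‖G y s‖ ^ 2) := by
  have hc := fun m => continuousOn_fourierCoeffOn hab hG m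
  have h1 : ∀ m : ℤ, ENNReal.ofReal (∫ y in (0 : ℝ)..1, ‖fourierCoeffOn hab (G y) m‖ ^ 2) =
      ∫⁻ y in Ioc (0 : ℝ) 1, ‖fourierCoeffOn hab (G y) m‖ₑ ^ 2 := fun m =>
    ofReal_integral_normSq zero_le_one (hc m)
  simp only [h1]
  rw [← lintegral_tsum]
  · have hcont : ContinuousOn (fun y => ∫ s in a..b, ‖G y s‖ ^ 2) (Icc 0 1) :=
      continuousOn_parametric_intervalIntegral hab.le (hG.norm.pow 2)
    have hnn : ∀ y, 0 ≤ ∫ s in a..b, ‖G y s‖ ^ 2 := fun y =>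
      intervalIntegral.integral_nonneg hab.le fun s _ => by positivity
    have hpos : 0 ≤ (b - a)⁻¹ := inv_nonneg.2 (by linarith)
    rw [← intervalIntegral.integral_const_mul, intervalIntegral.integral_of_le zero_le_one,
      ofReal_integral_eq_lintegral_ofReal]
    · refine setLIntegral_congr_fun measurableSet_Ioc fun y hy => ?_
      have hGy : ContinuousOn (G y) (Icc a b) :=
        hG.comp (f := fun s => (y, s)) (by fun_prop) fun s hs => ⟨Ioc_subset_Icc_self hy, hs⟩
      have hL2 : MemLp (G y) 2 (volume.restrict (Ioc a b)) :=
        by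
        obtain ⟨M, hM⟩ := isCompact_Icc.exists_bound_of_continuousOn hGy
        refine MemLp.of_bound ((hGy.mono Ioc_subset_Icc_self).aestronglyMeasurable
          measurableSet_Ioc) M ?_
        filter_upwards [ae_restrict_mem measurableSet_Ioc] with s hs
        exact hM s (Ioc_subset_Icc_self hs)
      have hs := hasSum_sq_fourierCoeffOn hab hL2
      simp only [smul_eq_mul] at hs
      rw [← hs.tsum_eq, ENNReal.ofReal_tsum_of_nonneg (fun _ => by positivity) hs.summable]
      refine tsum_congr fun m => ?_
      rw [ENNReal.ofReal_pow (norm_nonneg _), ofReal_norm]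
    · exact ((hcont.const_mul _).integrableOn_compact isCompact_Icc).mono_set Ioc_subset_Icc_self
    · exact ae_of_all _ fun y => mul_nonneg hpos (hnn y)
  · intro m
    exact ((((hc m).mono Ioc_subset_Icc_self).aestronglyMeasurable
      measurableSet_Ioc).enorm).pow_const 2

/-! ### Sublevel estimates for the shear profile -/

/-- On every short cell, any translate `b - lam` of the profile has a definite sign and is at least
of size `ℓ ^ (N + 1)` on a subinterval of comparable length. -/
def Nondegenerate (b : ℝ → ℝ) (N : ℕ) (c r : ℝ) : Prop :=
  ∀ lam a ℓ : ℝ, 0 ≤ a → 0 < ℓ → a + ℓ ≤ 1 → ℓ ≤ r →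
    ∃ a' b' σ : ℝ, a ≤ a' ∧ b' ≤ a + ℓ ∧ c * ℓ ≤ b' - a' ∧ (σ = 1 ∨ σ = -1) ∧
      ∀ y ∈ Icc a' b', c * ℓ ^ (N + 1) ≤ σ * (b y - lam)

/-- A function whose derivative has size at least `c` is of size at least `c (b - a) / 6` on the left
or on the right third of the interval, according to its sign at the midpoint. -/
theorem exists_third_of_deriv_ge {g g' : ℝ → ℝ} {a b c σ : ℝ} (hab : a < b) (hc : 0 < c)
    (hσ : σ = 1 ∨ σ = -1)
    (hg : ∀ y ∈ Icc a b, HasDerivWithinAt g (g' y) (Icc a b) y)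
    (hg' : ∀ y ∈ Icc a b, c ≤ σ * g' y) :
    ∃ a' σ' : ℝ, a ≤ a' ∧ a' + (b - a) / 3 ≤ b ∧ (σ' = 1 ∨ σ' = -1) ∧
      ∀ y ∈ Icc a' (a' + (b - a) / 3), c * (b - a) / 6 ≤ σ' * g y := by
  have key : ∀ x ∈ Icc a b, ∀ y ∈ Icc a b, x ≤ y → c * (y - x) ≤ σ * g y - σ * g x := by
    refine (convex_Icc a b).mul_sub_le_image_sub_of_le_deriv (f := fun y => σ * g y) ?_ ?_ ?_
    · exact fun y hy => ((hg y hy).continuousWithinAt).const_mul σ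
    · intro y hy
      rw [interior_Icc] at hy
      exact (((hg y (Ioo_subset_Icc_self hy)).hasDerivAt
        (Icc_mem_nhds hy.1 hy.2)).const_mul σ).differentiableAt.differentiableWithinAt
    · intro y hy
      rw [interior_Icc] at hy
      rw [(((hg y (Ioo_subset_Icc_self hy)).hasDerivAt
        (Icc_mem_nhds hy.1 hy.2)).const_mul σ).deriv]
      exact hg' y (Ioo_subset_Icc_self hy)
  have hm : (a + b) / 2 ∈ Icc a b := ⟨by linarith, by linarith⟩
  rcases le_total 0 (σ * g ((a + b) / 2)) with h | h
  · refine ⟨a + 2 * (b - a) / 3, σ, by linarith, by linarith, hσ, fun y hy => ?_⟩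
    have h1 := key _ hm y ⟨by linarith [hy.1], by linarith [hy.2]⟩ (by linarith [hy.1])
    nlinarith [hy.1]
  · refine ⟨a, -σ, le_rfl, by linarith, ?_, fun y hy => ?_⟩
    · rcases hσ with rfl | rfl <;> simp
    have h1 := key y ⟨by linarith [hy.1], by linarith [hy.2]⟩ _ hm (by linarith [hy.2])
    nlinarith [hy.2]

/-- Quantitative sublevel estimate: a function whose `n`-th derivative is bounded below by `c₀` in
absolute value is at least of order `c₀ ℓ ^ n` on a subinterval of length `ℓ / 3 ^ n`. -/
theorem exists_subinterval_of_iterated_deriv_ge (n : ℕ) :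
    ∃ c : ℝ, 0 < c ∧ ∀ (h : ℕ → ℝ → ℝ) (a b c₀ σ : ℝ), a < b → 0 < c₀ → (σ = 1 ∨ σ = -1) →
      (∀ j < n, ∀ y ∈ Icc a b, HasDerivWithinAt (h j) (h (j + 1) y) (Icc a b) y) →
      (∀ y ∈ Icc a b, c₀ ≤ σ * h n y) →
      ∃ a' σ' : ℝ, a ≤ a' ∧ a' + (b - a) / 3 ^ n ≤ b ∧ (σ' = 1 ∨ σ' = -1) ∧
        ∀ y ∈ Icc a' (a' + (b - a) / 3 ^ n), c * c₀ * (b - a) ^ n ≤ σ' * h 0 y := by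
  induction n with
  | zero =>
    refine ⟨1, one_pos, fun h a b c₀ σ hab hc₀ hσ _ hn => ⟨a, σ, le_rfl, by simp, hσ, ?_⟩⟩
    intro y hy
    have := hn y ⟨hy.1, by simpa using hy.2⟩
    simpa using this
  | succ n ih =>
    obtain ⟨c, hc, ih⟩ := ih
    refine ⟨c / 6 / 3 ^ n, by positivity, fun h a b c₀ σ hab hc₀ hσ hd hn => ?_⟩
    obtain ⟨a₁, σ₁, ha₁, hb₁, hσ₁, h₁⟩ := exists_third_of_deriv_ge hab hc₀ hσ
      (hd n (Nat.lt_succ_self n)) hn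
    have hsub : Icc a₁ (a₁ + (b - a) / 3) ⊆ Icc a b := Icc_subset_Icc ha₁ hb₁
    have hba : 0 < b - a := by linarith
    obtain ⟨a₂, σ₂, ha₂, hb₂, hσ₂, h₂⟩ := ih h a₁ (a₁ + (b - a) / 3) (c₀ * (b - a) / 6) σ₁
      (by linarith) (by positivity) hσ₁
      (fun j hj y hy => (hd j (hj.trans (Nat.lt_succ_self n)) y (hsub hy)).mono hsub) h₁
    have e : (a₁ + (b - a) / 3 - a₁) / 3 ^ n = (b - a) / 3 ^ (n + 1) := by
      rw [pow_succ]; field_simp; ring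
    rw [e] at hb₂ h₂
    refine ⟨a₂, σ₂, ha₁.trans ha₂, hb₂.trans hb₁, hσ₂, fun y hy => ?_⟩
    refine le_trans (le_of_eq ?_) (h₂ y hy)
    rw [add_sub_cancel_left, div_pow, pow_succ]
    field_simp

theorem CrossSection.Icc_subset_closed (D : CrossSection) : Icc (0 : ℝ) 1 ⊆ D.closed := by
  cases D
  · exact subset_univ _
  · exact subset_rfl

theorem CrossSection.uniqueDiffOn_closed (D : CrossSection) : UniqueDiffOn ℝ D.closed := by
  cases D
  · exact uniqueDiffOn_univ
  · exact uniqueDiffOn_Icc zero_lt_one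

theorem IsShearProfile.exists_iteratedDeriv_ne_zero {D : CrossSection} {b : ℝ → ℝ} {N : ℕ}
    (hb : IsShearProfile D b N) {y : ℝ} (hy : y ∈ Icc (0 : ℝ) 1) :
    ∃ n ∈ Finset.Icc 1 (N + 1), iteratedDerivWithin n b D.closed y ≠ 0 := by
  obtain ⟨⟨-, hper⟩, hfin, order, horder, rfl⟩ := hb
  have main : ∀ z ∈ D.points, ∃ n ∈ Finset.Icc 1 (hfin.toFinset.sup order + 1),
      iteratedDerivWithin n b D.closed z ≠ 0 := by
    intro z hz
    by_cases hcrit : derivWithin b D.closed z = 0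
    · have hzc : z ∈ criticalPoints D b := ⟨hz, hcrit⟩
      refine ⟨order z + 1, ?_, (horder z hzc).2⟩
      have : order z ≤ hfin.toFinset.sup order :=
        Finset.le_sup (f := order) (hfin.mem_toFinset.2 hzc)
      simp only [Finset.mem_Icc]
      omega
    · exact ⟨1, by simp, by rwa [iteratedDerivWithin_one]⟩
  by_cases hyp : y ∈ D.points
  · exact main y hyp
  · cases D with
    | interval => exact absurd hy hyp
    | torus =>
      -- the only missing point is `y = 1`, which periodicity identifies with `0`
      have hy1 : y = 1 := by
        by_contra hne
        exact hyp ⟨hy.1, lt_of_le_of_ne hy.2 hne⟩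
      obtain ⟨n, hn, hne⟩ := main 0 ⟨le_rfl, zero_lt_one⟩
      refine ⟨n, hn, ?_⟩
      rw [hy1]
      simp only [CrossSection.closed, iteratedDerivWithin_univ] at hne ⊢
      have hs : (fun z => b (z + 1)) = b := funext (hper rfl)
      have := congrFun (iteratedDeriv_comp_add_const n b 1) 0
      rw [hs] at this
      rwa [this, zero_add] at hne

/-- Compactness makes the finite order of vanishing quantitative: the derivatives of order
`1, …, N + 1` have no small common values, so on each short cell one of them is bounded below. -/
theorem IsShearProfile.exists_nondegenerate {D : CrossSection} {b : ℝ → ℝ} {N : ℕ}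
    (hb : IsShearProfile D b N) : ∃ c r : ℝ, 0 < c ∧ 0 < r ∧ r ≤ 1 ∧
      Nondegenerate b N c r := by
  have hsm : ContDiffOn ℝ ∞ b D.closed := hb.1.1
  have hU := D.uniqueDiffOn_closed
  have hcont : ∀ n : ℕ, ContinuousOn (iteratedDerivWithin n b D.closed) (Icc 0 1) := fun n =>
    (hsm.continuousOn_iteratedDerivWithin (by exact_mod_cast le_top) hU).mono
      D.Icc_subset_closed
  -- a uniform lower bound for the derivatives of order `1, …, N + 1`
  have hsum : ContinuousOn
      (fun y => ∑ n ∈ Finset.Icc 1 (N + 1), |iteratedDerivWithin n b D.closed y|) (Icc 0 1) :=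
    continuousOn_finsetSum _ fun n _ => (hcont n).abs
  obtain ⟨y₀, hy₀, hmin⟩ := isCompact_Icc.exists_isMinOn (nonempty_Icc.2 zero_le_one) hsum
  set m₀ := ∑ n ∈ Finset.Icc 1 (N + 1), |iteratedDerivWithin n b D.closed y₀| with hm₀
  have hm₀pos : 0 < m₀ := by
    obtain ⟨n, hn, hne⟩ := hb.exists_iteratedDeriv_ne_zero hy₀
    exact Finset.sum_pos' (fun _ _ => abs_nonneg _) ⟨n, hn, abs_pos.2 hne⟩
  set c₁ := m₀ / (2 * (N + 1)) with hc₁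
  have hc₁pos : 0 < c₁ := by positivity
  have hbig : ∀ y ∈ Icc (0 : ℝ) 1, ∃ n ∈ Finset.Icc 1 (N + 1),
      2 * c₁ ≤ |iteratedDerivWithin n b D.closed y| := by
    intro y hy
    by_contra! hcon
    have h1 : ∑ n ∈ Finset.Icc 1 (N + 1), |iteratedDerivWithin n b D.closed y| <
        ∑ _n ∈ Finset.Icc 1 (N + 1), 2 * c₁ :=
      Finset.sum_lt_sum_of_nonempty ⟨1, by simp⟩ hcon
    have h2 : ∑ _n ∈ Finset.Icc 1 (N + 1), 2 * c₁ = m₀ := by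
      simp only [Finset.sum_const, Nat.card_Icc, nsmul_eq_mul, hc₁]
      push_cast
      field_simp
    have h3 : m₀ ≤ ∑ n ∈ Finset.Icc 1 (N + 1), |iteratedDerivWithin n b D.closed y| := hmin hy
    linarith
  -- uniform continuity of these derivatives
  have hunif : ∀ n : ℕ, ∃ r > 0, ∀ x ∈ Icc (0 : ℝ) 1, ∀ y ∈ Icc (0 : ℝ) 1, |x - y| ≤ r →
      |iteratedDerivWithin n b D.closed x - iteratedDerivWithin n b D.closed y| ≤ c₁ := by
    intro n
    have := isCompact_Icc.uniformContinuousOn_of_continuous (hcont n)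
    obtain ⟨δ, hδ, h⟩ := Metric.uniformContinuousOn_iff.1 this c₁ hc₁pos
    refine ⟨δ / 2, by positivity, fun x hx y hy hxy => ?_⟩
    exact (h x hx y hy (by rw [Real.dist_eq]; linarith)).le
  choose ρ hρ hρ' using hunif
  choose κ hκ hκ' using exists_subinterval_of_iterated_deriv_ge
  obtain ⟨r, hr0, hr⟩ : ∃ r : ℝ, 0 < r ∧ ∀ n ∈ Finset.Icc 1 (N + 1), r ≤ ρ n := by
    obtain ⟨n, -, h⟩ := Finset.exists_min_image (Finset.Icc 1 (N + 1)) ρ ⟨1, by simp⟩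
    exact ⟨ρ n, hρ n, h⟩
  obtain ⟨k, hk0, hk⟩ : ∃ k : ℝ, 0 < k ∧ ∀ n ∈ Finset.Icc 1 (N + 1), k ≤ κ n := by
    obtain ⟨n, -, h⟩ := Finset.exists_min_image (Finset.Icc 1 (N + 1)) κ ⟨1, by simp⟩
    exact ⟨κ n, hκ n, h⟩
  refine ⟨min (k * c₁) (1 / 3 ^ (N + 1)), min r 1, by positivity,
    by positivity, min_le_right _ _, ?_⟩
  intro lam a ℓ ha hℓ haℓ hℓr
  have haI : a ∈ Icc (0 : ℝ) 1 := ⟨ha, by linarith⟩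
  obtain ⟨n, hn, hna⟩ := hbig a haI
  have hnN := Finset.mem_Icc.1 hn
  have hsub : Icc a (a + ℓ) ⊆ Icc 0 1 := Icc_subset_Icc ha haℓ
  obtain ⟨σ, hσ, hσn⟩ : ∃ σ : ℝ, (σ = 1 ∨ σ = -1) ∧
      ∀ y ∈ Icc a (a + ℓ), c₁ ≤ σ * iteratedDerivWithin n b D.closed y := by
    have hclose : ∀ y ∈ Icc a (a + ℓ),
        |iteratedDerivWithin n b D.closed y - iteratedDerivWithin n b D.closed a| ≤ c₁ := by
      intro y hy
      refine hρ' n y (hsub hy) a haI ?_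
      rw [abs_of_nonneg (by linarith [hy.1])]
      linarith [hy.2, hr n hn, hℓr.trans (min_le_left r 1)]
    rcases le_total 0 (iteratedDerivWithin n b D.closed a) with h | h
    · refine ⟨1, Or.inl rfl, fun y hy => ?_⟩
      rw [abs_of_nonneg h] at hna
      linarith [(abs_le.1 (hclose y hy)).1]
    · refine ⟨-1, Or.inr rfl, fun y hy => ?_⟩
      rw [abs_of_nonpos h] at hna
      linarith [(abs_le.1 (hclose y hy)).2]
  -- apply the sublevel estimate to `b - lam` and its derivatives
  let g : ℕ → ℝ → ℝ := fun j y => iteratedDerivWithin j b D.closed y - if j = 0 then lam else 0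
  have hg : ∀ j, ∀ y ∈ Icc a (a + ℓ), HasDerivWithinAt (g j) (g (j + 1) y) (Icc a (a + ℓ)) y := by
    intro j y hy
    have h1 : DifferentiableOn ℝ (iteratedDerivWithin j b D.closed) D.closed :=
      hsm.differentiableOn_iteratedDerivWithin (by exact_mod_cast WithTop.coe_lt_top _) hU
    have h2 := (h1 y (D.Icc_subset_closed (hsub hy))).hasDerivWithinAt
    rw [← iteratedDerivWithin_succ] at h2
    have h3 := (h2.mono (hsub.trans D.Icc_subset_closed)).sub_const (if j = 0 then lam else 0)
    simpa [g] using h3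
  obtain ⟨a', σ', ha', hb', hσ', h'⟩ := hκ' n g a (a + ℓ) c₁ σ (by linarith) hc₁pos hσ
    (fun j _ => hg j) (fun y hy => by
      have hn0 : n ≠ 0 := by omega
      simpa [g, hn0] using hσn y hy)
  rw [add_sub_cancel_left] at hb' h'
  have hℓ1 : ℓ ≤ 1 := hℓr.trans (min_le_right r 1)
  refine ⟨a', a' + ℓ / 3 ^ n, σ', ha', hb', ?_, hσ', fun y hy => ?_⟩
  · have h1 : min (k * c₁) (1 / 3 ^ (N + 1)) ≤ 1 / (3 : ℝ) ^ n :=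
      (min_le_right _ _).trans (one_div_le_one_div_of_le (by positivity)
        (pow_le_pow_right₀ (by norm_num) hnN.2))
    calc min (k * c₁) (1 / 3 ^ (N + 1)) * ℓ ≤ 1 / (3 : ℝ) ^ n * ℓ := by gcongr
      _ = a' + ℓ / 3 ^ n - a' := by ring
  · have h1 := h' y hy
    simp only [g, iteratedDerivWithin_zero, if_true] at h1
    refine le_trans ?_ h1
    have h2 : ℓ ^ (N + 1) ≤ ℓ ^ n := pow_le_pow_of_le_one hℓ.le hℓ1 hnN.2
    calc min (k * c₁) (1 / 3 ^ (N + 1)) * ℓ ^ (N + 1) ≤ k * c₁ * ℓ ^ n := by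
          gcongr
          exact min_le_left _ _
      _ ≤ κ n * c₁ * ℓ ^ n := by
          gcongr
          exact hk n hn

/-! ### The resolvent estimate -/

/-- `u` is twice continuously differentiable on `[0, 1]` with derivatives `u'` and `u''`; the
derivatives are only required in the interior, and extend continuously to the boundary. -/
structure IsC2 (u u' u'' : ℝ → ℂ) : Prop where
  cont : ContinuousOn u (Icc 0 1)
  cont' : ContinuousOn u' (Icc 0 1)
  cont'' : ContinuousOn u'' (Icc 0 1)
  deriv : ∀ y ∈ Ioo (0 : ℝ) 1, HasDerivAt u (u' y) y
  deriv' : ∀ y ∈ Ioo (0 : ℝ) 1, HasDerivAt u' (u'' y) y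

/-- The boundary condition for a single Fourier mode `v` with derivative `v'`. -/
def BoundaryCondition.HoldsMode : BoundaryCondition → (ℝ → ℂ) → (ℝ → ℂ) → Prop
  | .periodic, v, v' => v 1 = v 0 ∧ v' 1 = v' 0
  | .dirichlet, v, _ => v 0 = 0 ∧ v 1 = 0
  | .neumann, _, v' => v' 0 = 0 ∧ v' 1 = 0

/-- The squared `L²(0, 1)` norm. -/
noncomputable def modeEnergy (v : ℝ → ℂ) : ℝ := ∫ y in (0 : ℝ)..1, ‖v y‖ ^ 2

theorem modeEnergy_nonneg (v : ℝ → ℂ) : 0 ≤ modeEnergy v :=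
  intervalIntegral.integral_nonneg zero_le_one fun _ _ => by positivity

/-- The operator `i κ b - ν ∂_y²` with the boundary condition `bc` satisfies
`‖(i (κ b + μ) - ν ∂_y²) v‖ ≥ Ψ ‖v‖` in `L²(0, 1)` for all real `μ`, that is, its resolvent is bounded
by `1 / Ψ` on the imaginary axis. -/
def ResolventBound (bc : BoundaryCondition) (b : ℝ → ℝ) (κ ν Ψ : ℝ) : Prop :=
  ∀ (μ : ℝ) (v v' v'' F : ℝ → ℂ), IsC2 v v' v'' → bc.HoldsMode v v' →
    ContinuousOn F (Icc 0 1) →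
    (∀ y ∈ Ioo (0 : ℝ) 1, F y = Complex.I * (κ * b y + μ : ℝ) * v y - ν * v'' y) →
    Ψ ^ 2 * modeEnergy v ≤ modeEnergy F

theorem BoundaryCondition.HoldsMode.mul_conj_eq {bc : BoundaryCondition} {v v' : ℝ → ℂ}
    (h : bc.HoldsMode v v') : v' 1 * conj (v 1) = v' 0 * conj (v 0) := by
  cases bc <;> obtain ⟨h1, h2⟩ := h <;> simp [h1, h2]

theorem _root_.ContinuousOn.intervalIntegrable_of_subset {E : Type*} [NormedAddCommGroup E]
    {f : ℝ → E} {s : Set ℝ} (hf : ContinuousOn f s) {a b : ℝ} (hab : a ≤ b) (hs : Icc a b ⊆ s) :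
    IntervalIntegrable f volume a b :=
  ContinuousOn.intervalIntegrable (by rw [uIcc_of_le hab]; exact hf.mono hs)

namespace IsC2

variable {u u' u'' : ℝ → ℂ}

theorem cont_mul_conj (hu : IsC2 u u' u'') :
    ContinuousOn (fun y => u' y * conj (u y)) (Icc 0 1) :=
  hu.cont'.mul (Complex.continuous_conj.comp_continuousOn hu.cont)

theorem hasDerivAt_mul_conj (hu : IsC2 u u' u'') {y : ℝ} (hy : y ∈ Ioo (0 : ℝ) 1) :
    HasDerivAt (fun y => u' y * conj (u y)) (u'' y * conj (u y) + u' y * conj (u' y)) y :=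
  (hu.deriv' y hy).mul (Complex.conjCLE.toContinuousLinearMap.hasFDerivAt.comp_hasDerivAt y
    (hu.deriv y hy))

theorem hasDerivAt_normSq (hu : IsC2 u u' u'') {y : ℝ} (hy : y ∈ Ioo (0 : ℝ) 1) :
    HasDerivAt (fun y => ‖u y‖ ^ 2) (2 * (u' y * conj (u y)).re) y := by
  have h := (hu.deriv y hy).norm_sq
  refine h.congr_deriv ?_
  rw [Complex.inner]

/-- Integration by parts: the boundary condition removes the boundary terms. -/
theorem integral_re_deriv2_mul_conj (hu : IsC2 u u' u'') {bc : BoundaryCondition}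
    (hbc : bc.HoldsMode u u') :
    ∫ y in (0 : ℝ)..1, (u'' y * conj (u y)).re = -∫ y in (0 : ℝ)..1, ‖u' y‖ ^ 2 := by
  have hcc : ContinuousOn (fun y => (u'' y * conj (u y)).re) (Icc 0 1) :=
    Complex.continuous_re.comp_continuousOn
      (hu.cont''.mul (Complex.continuous_conj.comp_continuousOn hu.cont))
  have h1 := hcc.intervalIntegrable_of_subset zero_le_one subset_rfl
  have h2 : IntervalIntegrable (fun y => ‖u' y‖ ^ 2) volume 0 1 :=
    (hu.cont'.norm.pow 2).intervalIntegrable_of_subset zero_le_one subset_rfl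
  have h := intervalIntegral.integral_eq_sub_of_hasDerivAt_of_le zero_le_one
    (f := fun y => (u' y * conj (u y)).re)
    (f' := fun y => (u'' y * conj (u y)).re + ‖u' y‖ ^ 2)
    (Complex.continuous_re.comp_continuousOn hu.cont_mul_conj) (fun y hy => ?_) (h1.add h2)
  · rw [intervalIntegral.integral_add h1 h2, hbc.mul_conj_eq] at h
    linarith
  · have := Complex.reCLM.hasFDerivAt.comp_hasDerivAt y (hu.hasDerivAt_mul_conj hy)
    refine this.congr_deriv ?_
    simp [Complex.mul_conj, Complex.normSq_eq_norm_sq, -Complex.ofReal_pow]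

/-- Testing the equation against `φ ū` for a bump `φ` supported in an interval on which the
potential has a definite sign; no boundary terms arise. -/
theorem integral_bump_mul_normSq_le (hu : IsC2 u u' u'') {F : ℝ → ℂ}
    (hF : ContinuousOn F (Icc 0 1)) {h : ℝ → ℝ} {ν H τ a b : ℝ} (hν : 0 ≤ ν)
    (ha : 0 ≤ a) (hab : a ≤ b) (hb : b ≤ 1) (hτ : τ = 1 ∨ τ = -1)
    (hH : ∀ y ∈ Ioo a b, H ≤ τ * h y)
    (heq : ∀ y ∈ Ioo (0 : ℝ) 1, F y = Complex.I * h y * u y - ν * u'' y) :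
    H * ∫ y in a..b, (y - a) * (b - y) * ‖u y‖ ^ 2 ≤
      (b - a) ^ 2 * (∫ y in a..b, ‖F y‖ * ‖u y‖) + ν * (b - a) * ∫ y in a..b, ‖u' y‖ * ‖u y‖ := by
  have hsub : Icc a b ⊆ Icc 0 1 := Icc_subset_Icc ha hb
  have hcu := hu.cont.mono hsub
  have hcu' := hu.cont'.mono hsub
  have hcu'' := hu.cont''.mono hsub
  have hcF := hF.mono hsub
  have hconj : ContinuousOn (fun y => conj (u y)) (Icc a b) :=
    Complex.continuous_conj.comp_continuousOn hcu
  have him : ContinuousOn (fun y => (u' y * conj (u y)).im) (Icc a b) :=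
    Complex.continuous_im.comp_continuousOn (hcu'.mul hconj)
  have him' : ContinuousOn (fun y => (u'' y * conj (u y)).im) (Icc a b) :=
    Complex.continuous_im.comp_continuousOn (hcu''.mul hconj)
  let d : ℝ → ℝ := fun y => (a + b - 2 * y) * (u' y * conj (u y)).im +
    (y - a) * (b - y) * (u'' y * conj (u y)).im
  have hφ : ContinuousOn (fun y : ℝ => (y - a) * (b - y)) (Icc a b) :=
    Continuous.continuousOn (by fun_prop)
  have hφ' : ContinuousOn (fun y : ℝ => a + b - 2 * y) (Icc a b) :=
    Continuous.continuousOn (by fun_prop)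
  have hcd : ContinuousOn d (Icc a b) := (hφ'.mul him).add (hφ.mul him')
  have hd0 : ∫ y in a..b, d y = 0 := by
    rw [intervalIntegral.integral_eq_sub_of_hasDerivAt_of_le hab
      (f := fun y => (y - a) * (b - y) * (u' y * conj (u y)).im) (hφ.mul him) (fun y hy => ?_)
      (hcd.intervalIntegrable_of_subset hab subset_rfl)]
    · simp
    · have hy' : y ∈ Ioo (0 : ℝ) 1 := ⟨ha.trans_lt hy.1, hy.2.trans_le hb⟩
      have h1 := Complex.imCLM.hasFDerivAt.comp_hasDerivAt y (hu.hasDerivAt_mul_conj hy')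
      have h2 : HasDerivAt (fun y => (u' y * conj (u y)).im) ((u'' y * conj (u y)).im) y := by
        refine h1.congr_deriv ?_
        simp [Complex.mul_conj]
      have h3 : HasDerivAt (fun y : ℝ => (y - a) * (b - y)) (a + b - 2 * y) y := by
        refine (((hasDerivAt_id y).sub_const a).mul ((hasDerivAt_id y).const_sub b)).congr_deriv ?_
        simp only [id]; ring
      exact h3.mul h2
  have hi1 : IntervalIntegrable (fun y => (y - a) * (b - y) * ‖u y‖ ^ 2) volume a b :=
    (hφ.mul (hcu.norm.pow 2)).intervalIntegrable_of_subset hab subset_rfl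
  have hi2 : IntervalIntegrable (fun y => ‖F y‖ * ‖u y‖) volume a b :=
    (hcF.norm.mul hcu.norm).intervalIntegrable_of_subset hab subset_rfl
  have hi3 : IntervalIntegrable (fun y => ‖u' y‖ * ‖u y‖) volume a b :=
    (hcu'.norm.mul hcu.norm).intervalIntegrable_of_subset hab subset_rfl
  have hid := hcd.intervalIntegrable_of_subset hab subset_rfl
  have hmono := intervalIntegral.integral_mono_on_of_le_Ioo hab
    (f := fun y => H * ((y - a) * (b - y) * ‖u y‖ ^ 2) - τ * ν * d y)
    (g := fun y => (b - a) ^ 2 * (‖F y‖ * ‖u y‖) + ν * (b - a) * (‖u' y‖ * ‖u y‖))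
    ((hi1.const_mul _).sub (hid.const_mul _)) ((hi2.const_mul _).add (hi3.const_mul _))
    (fun y hy => ?_)
  · rw [intervalIntegral.integral_sub (hi1.const_mul _) (hid.const_mul _),
      intervalIntegral.integral_add (hi2.const_mul _) (hi3.const_mul _)] at hmono
    simp only [intervalIntegral.integral_const_mul, hd0, mul_zero, sub_zero] at hmono
    exact hmono
  · have hy' : y ∈ Ioo (0 : ℝ) 1 := ⟨ha.trans_lt hy.1, hy.2.trans_le hb⟩
    have hy1 : 0 < y - a := sub_pos.2 hy.1
    have hy2 : 0 < b - y := sub_pos.2 hy.2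
    have hFim : (F y * conj (u y)).im = h y * ‖u y‖ ^ 2 - ν * (u'' y * conj (u y)).im := by
      rw [heq y hy', ← Complex.normSq_eq_norm_sq]
      simp [Complex.normSq_apply]
      ring
    have habsF : |(F y * conj (u y)).im| ≤ ‖F y‖ * ‖u y‖ := by
      refine (Complex.abs_im_le_norm _).trans_eq ?_
      rw [norm_mul, RCLike.norm_conj]
    have habsu : |(u' y * conj (u y)).im| ≤ ‖u' y‖ * ‖u y‖ := by
      refine (Complex.abs_im_le_norm _).trans_eq ?_
      rw [norm_mul, RCLike.norm_conj]
    have hτabs : |τ| = 1 := by rcases hτ with rfl | rfl <;> simp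
    have hφ0 : 0 ≤ (y - a) * (b - y) := by positivity
    have hφ1 : (y - a) * (b - y) ≤ (b - a) ^ 2 := by nlinarith
    have e1 : H * ((y - a) * (b - y) * ‖u y‖ ^ 2) ≤
        τ * h y * ((y - a) * (b - y) * ‖u y‖ ^ 2) :=
      mul_le_mul_of_nonneg_right (hH y hy) (by positivity)
    have e2 : τ * ((y - a) * (b - y)) * (F y * conj (u y)).im ≤
        (b - a) ^ 2 * (‖F y‖ * ‖u y‖) := by
      refine (le_abs_self _).trans ?_
      rw [abs_mul, abs_mul, hτabs, one_mul, abs_of_nonneg hφ0]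
      gcongr
    have e3 : -(τ * ν * (a + b - 2 * y) * (u' y * conj (u y)).im) ≤
        ν * (b - a) * (‖u' y‖ * ‖u y‖) := by
      refine (neg_le_abs _).trans ?_
      rw [abs_mul, abs_mul, abs_mul, hτabs, one_mul, abs_of_nonneg hν]
      have : |a + b - 2 * y| ≤ b - a := abs_le.2 ⟨by linarith, by linarith⟩
      gcongr
    simp only [d]
    rw [hFim] at e2
    linarith

/-- A weighted Poincaré inequality: on a cell `[p, q]`, the mass of `u` is controlled by its
weighted mass on a subinterval `[a, b]` and by `∫ |u'| |u|`. -/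
theorem poincare_bump (hu : IsC2 u u' u'') {p q a b : ℝ} (hp : 0 ≤ p) (hq : q ≤ 1)
    (hpa : p ≤ a) (hab : a ≤ b) (hbq : b ≤ q) :
    (b - a) ^ 3 / 6 * ((∫ y in p..q, ‖u y‖ ^ 2) - 2 * (q - p) * ∫ y in p..q, ‖u' y‖ * ‖u y‖) ≤
      (q - p) * ∫ y in a..b, (y - a) * (b - y) * ‖u y‖ ^ 2 := by
  have hpq : p ≤ q := hpa.trans (hab.trans hbq)
  have hsub : Icc p q ⊆ Icc 0 1 := Icc_subset_Icc hp hq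
  have hsub' : Icc a b ⊆ Icc p q := Icc_subset_Icc hpa hbq
  have hcu := hu.cont.mono hsub
  have hcu' := hu.cont'.mono hsub
  have hi : ContinuousOn (fun y => ‖u' y‖ * ‖u y‖) (Icc p q) := hcu'.norm.mul hcu.norm
  have hre : ContinuousOn (fun y => 2 * (u' y * conj (u y)).re) (Icc p q) :=
    (Complex.continuous_re.comp_continuousOn (hu.cont_mul_conj.mono hsub)).const_mul 2
  set P := ∫ y in p..q, ‖u' y‖ * ‖u y‖ with hP
  have hosc' : ∀ x y, p ≤ x → x ≤ y → y ≤ q → |‖u y‖ ^ 2 - ‖u x‖ ^ 2| ≤ 2 * P := by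
    intro x y hpx hxy hyq
    have hs : Icc x y ⊆ Icc p q := Icc_subset_Icc hpx hyq
    rw [← intervalIntegral.integral_eq_sub_of_hasDerivAt_of_le hxy
      (f := fun y => ‖u y‖ ^ 2) ((hcu.mono hs).norm.pow 2) (fun z hz => hu.hasDerivAt_normSq
        ⟨(hp.trans hpx).trans_lt hz.1, hz.2.trans_le (hyq.trans hq)⟩)
      (hre.intervalIntegrable_of_subset hxy hs)]
    calc |∫ z in x..y, 2 * (u' z * conj (u z)).re|
        ≤ ∫ z in x..y, |2 * (u' z * conj (u z)).re| :=
          intervalIntegral.abs_integral_le_integral_abs hxy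
      _ ≤ ∫ z in x..y, 2 * (‖u' z‖ * ‖u z‖) := by
          refine intervalIntegral.integral_mono_on hxy
            (hre.abs.intervalIntegrable_of_subset hxy hs)
            ((hi.const_mul 2).intervalIntegrable_of_subset hxy hs) fun z _ => ?_
          rw [abs_mul, abs_two]
          refine mul_le_mul_of_nonneg_left ((Complex.abs_re_le_norm _).trans_eq ?_) two_pos.le
          rw [norm_mul, RCLike.norm_conj]
      _ ≤ 2 * P := by
          rw [intervalIntegral.integral_const_mul]
          refine mul_le_mul_of_nonneg_left ?_ two_pos.le
          exact intervalIntegral.integral_mono_interval hpx hxy hyq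
            (ae_of_all _ fun z => by positivity) (hi.intervalIntegrable_of_subset hpq subset_rfl)
  have hosc : ∀ x ∈ Icc p q, ∀ y ∈ Icc p q, ‖u x‖ ^ 2 - 2 * P ≤ ‖u y‖ ^ 2 := by
    intro x hx y hy
    rcases le_total x y with hxy | hxy
    · linarith [(abs_le.1 (hosc' x y hx.1 hxy hy.2)).1]
    · linarith [(abs_le.1 (hosc' y x hy.1 hxy hx.2)).2]
  have hwint : ∫ y in a..b, (y - a) * (b - y) = (b - a) ^ 3 / 6 := by
    rw [intervalIntegral.integral_eq_sub_of_hasDerivAt_of_le hab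
      (f := fun y => (y - a) ^ 2 * (b - a) / 2 - (y - a) ^ 3 / 3)
      (Continuous.continuousOn (by fun_prop)) (fun y _ => ?_)
      (Continuous.intervalIntegrable (by fun_prop) _ _)]
    · ring
    · have h1 := (hasDerivAt_id y).sub_const a
      refine ((((h1.pow 2).mul_const (b - a)).div_const 2).sub ((h1.pow 3).div_const 3)).congr_deriv
        ?_
      simp only [id]; push_cast; ring
  have hx : ∀ x ∈ Icc p q, (b - a) ^ 3 / 6 * (‖u x‖ ^ 2 - 2 * P) ≤
      ∫ y in a..b, (y - a) * (b - y) * ‖u y‖ ^ 2 := by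
    intro x hx
    have hφ : ContinuousOn (fun y : ℝ => (y - a) * (b - y)) (Icc a b) :=
      Continuous.continuousOn (by fun_prop)
    rw [← hwint, ← intervalIntegral.integral_mul_const]
    refine intervalIntegral.integral_mono_on hab
      ((hφ.mul continuousOn_const).intervalIntegrable_of_subset hab subset_rfl)
      ((hφ.mul ((hcu.mono hsub').norm.pow 2)).intervalIntegrable_of_subset hab subset_rfl)
      fun y hy => ?_
    exact mul_le_mul_of_nonneg_left (hosc x hx y (hsub' hy))
      (mul_nonneg (by linarith [hy.1]) (by linarith [hy.2]))
  have hi2 : IntervalIntegrable (fun x => ‖u x‖ ^ 2) volume p q :=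
    (hcu.norm.pow 2).intervalIntegrable_of_subset hpq subset_rfl
  have hint := intervalIntegral.integral_mono_on hpq
    ((hi2.sub intervalIntegrable_const).const_mul _) intervalIntegrable_const hx
  rw [intervalIntegral.integral_const_mul, intervalIntegral.integral_sub hi2
    intervalIntegrable_const, intervalIntegral.integral_const, intervalIntegral.integral_const,
    smul_eq_mul, smul_eq_mul] at hint
  linarith

/-- The resolvent estimate localized to one cell `[a, a + ℓ]`, at the scale where diffusion
`ν / ℓ ^ 2` and shear `K ℓ ^ (N + 1)` balance. -/
theorem cell_estimate (hu : IsC2 u u' u'') {F : ℝ → ℂ} (hF : ContinuousOn F (Icc 0 1))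
    {h : ℝ → ℝ} {ν τ a ℓ a' b' c B M : ℝ} (hν : 0 ≤ ν) (hc : 0 < c)
    (hB : 0 < B) (hM : 0 ≤ M) (ha : 0 ≤ a) (hℓ : 0 < ℓ) (haℓ : a + ℓ ≤ 1) (haa' : a ≤ a')
    (hb' : b' ≤ a + ℓ) (hw : c * ℓ ≤ b' - a') (hτ : τ = 1 ∨ τ = -1)
    (hH : ∀ y ∈ Ioo a' b', c * B ≤ τ * h y)
    (heq : ∀ y ∈ Ioo (0 : ℝ) 1, F y = Complex.I * h y * u y - ν * u'' y)
    (hνl : B * ℓ ^ 2 ≤ ν) (hνu : ν ≤ M * (B * ℓ ^ 2)) :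
    B * ∫ y in a..(a + ℓ), ‖u y‖ ^ 2 ≤ (12 / c ^ 3 + (2 + 6 * M / c ^ 3) ^ 2) *
      ((∫ y in a..(a + ℓ), ‖F y‖ * ‖u y‖) + ν * ∫ y in a..(a + ℓ), ‖u' y‖ ^ 2) := by
  have hpq : a ≤ a + ℓ := by linarith
  have hsub : Icc a (a + ℓ) ⊆ Icc 0 1 := Icc_subset_Icc ha haℓ
  have hcu := hu.cont.mono hsub
  have hcu' := hu.cont'.mono hsub
  have hcF := hF.mono hsub
  have hiG : IntervalIntegrable (fun y => ‖F y‖ * ‖u y‖) volume a (a + ℓ) :=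
    (hcF.norm.mul hcu.norm).intervalIntegrable_of_subset hpq subset_rfl
  have hiP : IntervalIntegrable (fun y => ‖u' y‖ * ‖u y‖) volume a (a + ℓ) :=
    (hcu'.norm.mul hcu.norm).intervalIntegrable_of_subset hpq subset_rfl
  have hiU : IntervalIntegrable (fun y => ‖u y‖ ^ 2) volume a (a + ℓ) :=
    (hcu.norm.pow 2).intervalIntegrable_of_subset hpq subset_rfl
  have hiV : IntervalIntegrable (fun y => ‖u' y‖ ^ 2) volume a (a + ℓ) :=
    (hcu'.norm.pow 2).intervalIntegrable_of_subset hpq subset_rfl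
  have hcℓ : 0 < c * ℓ := by positivity
  have hab' : a' ≤ b' := by linarith
  have h1 := hu.integral_bump_mul_normSq_le hF hν (ha.trans haa') hab' (hb'.trans haℓ) hτ hH heq
  have h2 := hu.poincare_bump ha haℓ haa' hab' hb'
  have hG' : ∫ y in a'..b', ‖F y‖ * ‖u y‖ ≤ ∫ y in a..(a + ℓ), ‖F y‖ * ‖u y‖ :=
    intervalIntegral.integral_mono_interval haa' hab' hb'
      (ae_of_all _ fun z => by positivity) hiG
  have hP' : ∫ y in a'..b', ‖u' y‖ * ‖u y‖ ≤ ∫ y in a..(a + ℓ), ‖u' y‖ * ‖u y‖ :=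
    intervalIntegral.integral_mono_interval haa' hab' hb'
      (ae_of_all _ fun z => by positivity) hiP
  have hG0 : 0 ≤ ∫ y in a..(a + ℓ), ‖F y‖ * ‖u y‖ :=
    intervalIntegral.integral_nonneg hpq fun y _ => by positivity
  have hP0 : 0 ≤ ∫ y in a..(a + ℓ), ‖u' y‖ * ‖u y‖ :=
    intervalIntegral.integral_nonneg hpq fun y _ => by positivity
  have hV0 : 0 ≤ ∫ y in a..(a + ℓ), ‖u' y‖ ^ 2 :=
    intervalIntegral.integral_nonneg hpq fun y _ => by positivity
  set L := 2 + 6 * M / c ^ 3 with hL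
  have hL0 : 0 ≤ L := by positivity
  -- absorb the mixed term
  have hmix : 2 * (L * ℓ * ∫ y in a..(a + ℓ), ‖u' y‖ * ‖u y‖) ≤
      (∫ y in a..(a + ℓ), ‖u y‖ ^ 2) + L ^ 2 * ℓ ^ 2 * ∫ y in a..(a + ℓ), ‖u' y‖ ^ 2 := by
    rw [← intervalIntegral.integral_const_mul, ← intervalIntegral.integral_const_mul,
      ← intervalIntegral.integral_const_mul, ← intervalIntegral.integral_add hiU (hiV.const_mul _)]
    refine intervalIntegral.integral_mono_on hpq ((hiP.const_mul _).const_mul _)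
      (hiU.add (hiV.const_mul _)) fun y _ => ?_
    linarith [sq_nonneg (‖u y‖ - L * ℓ * ‖u' y‖)]
  set U := ∫ y in a..(a + ℓ), ‖u y‖ ^ 2
  set V := ∫ y in a..(a + ℓ), ‖u' y‖ ^ 2
  set G := ∫ y in a..(a + ℓ), ‖F y‖ * ‖u y‖
  set P := ∫ y in a..(a + ℓ), ‖u' y‖ * ‖u y‖
  set Q := ∫ y in a'..b', (y - a') * (b' - y) * ‖u y‖ ^ 2
  rw [add_sub_cancel_left] at h2
  set w := b' - a' with hwdef
  have hw0 : 0 < w := hcℓ.trans_le hw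
  have hwℓ : w ≤ ℓ := by linarith
  -- combine the bump estimate with the Poincaré inequality
  have h3 : c ^ 3 / 6 * (B * (U - 2 * ℓ * P)) ≤ G + M * (B * ℓ) * P := by
    rcases le_total (U - 2 * ℓ * P) 0 with hneg | hpos
    · have : c ^ 3 / 6 * (B * (U - 2 * ℓ * P)) ≤ 0 :=
        mul_nonpos_of_nonneg_of_nonpos (by positivity)
          (mul_nonpos_of_nonneg_of_nonpos hB.le hneg)
      have : 0 ≤ G + M * (B * ℓ) * P := by positivity
      linarith
    · have e1 : c * B * (w ^ 3 / 6 * (U - 2 * ℓ * P)) ≤ ℓ * (w ^ 2 * G + ν * w * P) := by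
        calc c * B * (w ^ 3 / 6 * (U - 2 * ℓ * P)) ≤ c * B * (ℓ * Q) := by gcongr
          _ = ℓ * (c * B * Q) := by ring
          _ ≤ ℓ * (w ^ 2 * G + ν * w * P) := by
            refine mul_le_mul_of_nonneg_left (h1.trans ?_) hℓ.le
            gcongr
      have e2 : c * B * ((c * ℓ) ^ 2 / 6 * (U - 2 * ℓ * P)) * w ≤
          (ℓ ^ 2 * (G + M * (B * ℓ) * P)) * w := by
        calc c * B * ((c * ℓ) ^ 2 / 6 * (U - 2 * ℓ * P)) * w
            ≤ c * B * (w ^ 2 / 6 * (U - 2 * ℓ * P)) * w := by gcongr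
          _ = c * B * (w ^ 3 / 6 * (U - 2 * ℓ * P)) := by ring
          _ ≤ ℓ * (w ^ 2 * G + ν * w * P) := e1
          _ = ℓ * (w * G + ν * P) * w := by ring
          _ ≤ ℓ * (ℓ * G + (M * (B * ℓ ^ 2)) * P) * w := by gcongr
          _ = (ℓ ^ 2 * (G + M * (B * ℓ) * P)) * w := by ring
      have e3 := le_of_mul_le_mul_right e2 hw0
      refine le_of_mul_le_mul_left (a := ℓ ^ 2) ?_ (by positivity)
      refine le_trans (le_of_eq ?_) e3
      ring
  have h4 : B * U ≤ 6 / c ^ 3 * G + B * (L * ℓ * P) := by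
    have := mul_le_mul_of_nonneg_left h3 (show (0 : ℝ) ≤ 6 / c ^ 3 by positivity)
    have e : 6 / c ^ 3 * (c ^ 3 / 6 * (B * (U - 2 * ℓ * P))) = B * (U - 2 * ℓ * P) := by
      field_simp
    rw [e] at this
    have e' : B * (L * ℓ * P) = 2 * B * ℓ * P + 6 / c ^ 3 * (M * (B * ℓ) * P) := by
      rw [hL]; ring
    rw [e']
    linarith
  have h5 : B * U ≤ 12 / c ^ 3 * G + L ^ 2 * (ν * V) := by
    have e1 := mul_le_mul_of_nonneg_left hmix hB.le
    have e2 : L ^ 2 * (B * ℓ ^ 2 * V) ≤ L ^ 2 * (ν * V) := by gcongr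
    have e3 : 12 / c ^ 3 * G = 2 * (6 / c ^ 3 * G) := by ring
    rw [e3]
    linarith
  have h6 : 0 ≤ L ^ 2 * G := by positivity
  have h7 : 0 ≤ 12 / c ^ 3 * (ν * V) := by positivity
  linarith

end IsC2

/-- The resolvent estimate: `‖(i (κ b + μ) - ν ∂_y²) u‖ ≥ c |κ| δ ^ (N + 1) ‖u‖`, where
`δ ^ (N + 3) = ν / |κ|`, uniformly in the spectral parameter `μ`. -/
theorem Nondegenerate.resolvent_estimate {b : ℝ → ℝ} {N : ℕ} {c r : ℝ}
    (hb : Nondegenerate b N c r) (hc : 0 < c) (hr : r ≤ 1) :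
    ∃ C : ℝ, 0 < C ∧ ∀ (bc : BoundaryCondition) (κ ν δ : ℝ), κ ≠ 0 → 0 < δ → δ ≤ r →
      ν = |κ| * δ ^ (N + 3) → ResolventBound bc b κ ν (C * (|κ| * δ ^ (N + 1))) := by
  set M : ℝ := 2 ^ (N + 3) with hM
  set C₁ : ℝ := 12 / c ^ 3 + (2 + 6 * M / c ^ 3) ^ 2 with hC₁
  have hC₁0 : 0 < C₁ := by positivity
  refine ⟨1 / (2 * C₁ * 2 ^ (N + 1)), by positivity, ?_⟩
  intro bc κ ν δ hκ hδ hδr hν μ u u' u'' F hu hbc hF heq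
  have hK : 0 < |κ| := abs_pos.2 hκ
  have hν0 : 0 < ν := by rw [hν]; positivity
  -- cells of length `ℓ = 1 / n` with `δ / 2 ≤ ℓ ≤ δ`
  obtain ⟨n, hn0, hnl, hnu⟩ : ∃ n : ℕ, 0 < n ∧ (1 : ℝ) / n ≤ δ ∧ δ ≤ 2 * (1 / n) := by
    have hδ1 : δ ≤ 1 := hδr.trans hr
    have h1 : 1 / δ ≤ ⌈1 / δ⌉₊ := Nat.le_ceil _
    have h2 : (⌈1 / δ⌉₊ : ℝ) < 1 / δ + 1 := Nat.ceil_lt_add_one (by positivity)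
    have h0 : 1 ≤ 1 / δ := by rw [le_div_iff₀ hδ]; linarith
    have hpos : (0 : ℝ) < ⌈1 / δ⌉₊ := by linarith
    refine ⟨⌈1 / δ⌉₊, by exact_mod_cast hpos, ?_, ?_⟩
    · rw [div_le_iff₀ hpos]
      rw [div_le_iff₀ hδ] at h1
      linarith
    · rw [mul_one_div, le_div_iff₀ hpos]
      have : δ * (⌈1 / δ⌉₊ : ℝ) ≤ δ * (1 / δ + 1) := by gcongr
      have e : δ * (1 / δ + 1) = 1 + δ := by field_simp
      linarith
  have hn0' : (0 : ℝ) < n := by exact_mod_cast hn0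
  set ℓ : ℝ := 1 / n with hℓ
  have hℓ0 : 0 < ℓ := by positivity
  set B := |κ| * ℓ ^ (N + 1) with hB
  have hB0 : 0 < B := by positivity
  have hνl : B * ℓ ^ 2 ≤ ν := by
    rw [hν, hB, mul_assoc, ← pow_add]
    gcongr
  have hνu : ν ≤ M * (B * ℓ ^ 2) := by
    have e : M * (B * ℓ ^ 2) = |κ| * (2 * ℓ) ^ (N + 3) := by
      rw [hB, hM, mul_pow]; ring
    rw [e, hν]
    gcongr
  have hnℓ : (n : ℝ) * ℓ = 1 := by rw [hℓ]; field_simp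
  have hcell : ∀ i < n, B * ∫ y in ((i : ℕ) * ℓ)..((i + 1 : ℕ) * ℓ), ‖u y‖ ^ 2 ≤
      C₁ * ((∫ y in ((i : ℕ) * ℓ)..((i + 1 : ℕ) * ℓ), ‖F y‖ * ‖u y‖) +
        ν * ∫ y in ((i : ℕ) * ℓ)..((i + 1 : ℕ) * ℓ), ‖u' y‖ ^ 2) := by
    intro i hi
    have hi' : ((i + 1 : ℕ) : ℝ) ≤ n := by exact_mod_cast hi
    have e : ((i + 1 : ℕ) : ℝ) * ℓ = i * ℓ + ℓ := by push_cast; ring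
    have ha0 : (0 : ℝ) ≤ i * ℓ := by positivity
    have ha1 : i * ℓ + ℓ ≤ 1 := by
      rw [← e, ← hnℓ]
      gcongr
    obtain ⟨a', b', σ, haa', hb', hw, hσ, hy⟩ := hb (-μ / κ) (i * ℓ) ℓ ha0 hℓ0 ha1
      (hnl.trans hδr)
    rw [e]
    obtain ⟨τ, hτ, hτκ⟩ : ∃ τ : ℝ, (τ = 1 ∨ τ = -1) ∧ τ * κ = σ * |κ| := by
      rcases lt_or_gt_of_ne hκ with h | h
      · refine ⟨-σ, ?_, by rw [abs_of_neg h]; ring⟩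
        rcases hσ with rfl | rfl <;> simp
      · exact ⟨σ, hσ, by rw [abs_of_pos h]⟩
    refine hu.cell_estimate hF (h := fun y => κ * b y + μ) hν0.le hc hB0 (by positivity) ha0 hℓ0
      ha1 haa' hb' hw hτ (fun y hy' => ?_) heq hνl hνu
    have h1 := hy y (Ioo_subset_Icc_self hy')
    calc c * B = |κ| * (c * ℓ ^ (N + 1)) := by rw [hB]; ring
      _ ≤ |κ| * (σ * (b y - -μ / κ)) := by gcongr
      _ = (σ * |κ|) * (b y - -μ / κ) := by ring
      _ = τ * (κ * b y + μ) := by rw [← hτκ]; field_simp; ring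
  -- sum over the cells
  have hsum : ∀ g : ℝ → ℝ, ContinuousOn g (Icc 0 1) →
      ∑ i ∈ Finset.range n, ∫ y in ((i : ℕ) * ℓ)..((i + 1 : ℕ) * ℓ), g y =
        ∫ y in (0 : ℝ)..1, g y := by
    intro g hg
    rw [intervalIntegral.sum_integral_adjacent_intervals (a := fun i : ℕ => (i : ℝ) * ℓ)]
    · rw [hnℓ]; simp
    · intro i hi
      have hi' : ((i + 1 : ℕ) : ℝ) ≤ n := by exact_mod_cast hi
      refine hg.intervalIntegrable_of_subset ?_ (Icc_subset_Icc (by positivity) ?_)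
      · gcongr; exact Nat.le_succ i
      · rw [← hnℓ]; gcongr
  have hcG : ContinuousOn (fun y => ‖F y‖ * ‖u y‖) (Icc 0 1) := hF.norm.mul hu.cont.norm
  have hcU : ContinuousOn (fun y => ‖u y‖ ^ 2) (Icc 0 1) := hu.cont.norm.pow 2
  have hcV : ContinuousOn (fun y => ‖u' y‖ ^ 2) (Icc 0 1) := hu.cont'.norm.pow 2
  have htot := Finset.sum_le_sum fun i hi => hcell i (Finset.mem_range.1 hi)
  rw [← Finset.mul_sum, ← Finset.mul_sum, Finset.sum_add_distrib, ← Finset.mul_sum,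
    hsum _ hcG, hsum _ hcU, hsum _ hcV] at htot
  -- the energy identity controls the dissipation
  have hiG := hcG.intervalIntegrable_of_subset zero_le_one subset_rfl
  have hiU := hcU.intervalIntegrable_of_subset zero_le_one subset_rfl
  have hiF : IntervalIntegrable (fun y => ‖F y‖ ^ 2) volume 0 1 :=
    (hF.norm.pow 2).intervalIntegrable_of_subset zero_le_one subset_rfl
  have henergy : ν * ∫ y in (0 : ℝ)..1, ‖u' y‖ ^ 2 ≤ ∫ y in (0 : ℝ)..1, ‖F y‖ * ‖u y‖ := by
    have h1 := hu.integral_re_deriv2_mul_conj hbc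
    have e : ν * ∫ y in (0 : ℝ)..1, ‖u' y‖ ^ 2 =
        ∫ y in (0 : ℝ)..1, -ν * (u'' y * conj (u y)).re := by
      rw [intervalIntegral.integral_const_mul, h1]; ring
    rw [e]
    have hcc : ContinuousOn (fun y => (u'' y * conj (u y)).re) (Icc 0 1) :=
      Complex.continuous_re.comp_continuousOn
        (hu.cont''.mul (Complex.continuous_conj.comp_continuousOn hu.cont))
    refine intervalIntegral.integral_mono_on_of_le_Ioo zero_le_one
      ((hcc.const_mul _).intervalIntegrable_of_subset zero_le_one subset_rfl) hiG fun y hy => ?_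
    have h2 : (F y * conj (u y)).re = -ν * (u'' y * conj (u y)).re := by
      rw [heq y hy]
      simp
      ring
    rw [← h2]
    refine (Complex.re_le_norm _).trans_eq ?_
    rw [norm_mul, RCLike.norm_conj]
  have h1 : B * ∫ y in (0 : ℝ)..1, ‖u y‖ ^ 2 ≤
      2 * C₁ * ∫ y in (0 : ℝ)..1, ‖F y‖ * ‖u y‖ := by
    refine htot.trans ?_
    calc _ ≤ C₁ * ((∫ y in (0 : ℝ)..1, ‖F y‖ * ‖u y‖) + ∫ y in (0 : ℝ)..1, ‖F y‖ * ‖u y‖) := by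
          gcongr
      _ = _ := by ring
  have h2 : 2 * (2 * C₁ * B * ∫ y in (0 : ℝ)..1, ‖F y‖ * ‖u y‖) ≤
      (2 * C₁) ^ 2 * (∫ y in (0 : ℝ)..1, ‖F y‖ ^ 2) + B ^ 2 * ∫ y in (0 : ℝ)..1, ‖u y‖ ^ 2 := by
    rw [← intervalIntegral.integral_const_mul, ← intervalIntegral.integral_const_mul,
      ← intervalIntegral.integral_const_mul, ← intervalIntegral.integral_const_mul,
      ← intervalIntegral.integral_add (hiF.const_mul _) (hiU.const_mul _)]
    refine intervalIntegral.integral_mono_on zero_le_one ((hiG.const_mul _).const_mul _)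
      ((hiF.const_mul _).add (hiU.const_mul _)) fun y _ => ?_
    linarith [sq_nonneg (2 * C₁ * ‖F y‖ - B * ‖u y‖)]
  have h3 : B ^ 2 * (∫ y in (0 : ℝ)..1, ‖u y‖ ^ 2) ≤
      (2 * C₁) ^ 2 * ∫ y in (0 : ℝ)..1, ‖F y‖ ^ 2 := by
    have := mul_le_mul_of_nonneg_left h1 hB0.le
    linarith
  have hU0 : 0 ≤ ∫ y in (0 : ℝ)..1, ‖u y‖ ^ 2 :=
    intervalIntegral.integral_nonneg zero_le_one fun y _ => by positivity
  have h4 : |κ| * δ ^ (N + 1) ≤ 2 ^ (N + 1) * B := by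
    calc |κ| * δ ^ (N + 1) ≤ |κ| * (2 * ℓ) ^ (N + 1) := by gcongr
      _ = 2 ^ (N + 1) * B := by rw [hB, mul_pow]; ring
  calc (1 / (2 * C₁ * 2 ^ (N + 1)) * (|κ| * δ ^ (N + 1))) ^ 2 * ∫ y in (0 : ℝ)..1, ‖u y‖ ^ 2
      ≤ (1 / (2 * C₁ * 2 ^ (N + 1)) * (2 ^ (N + 1) * B)) ^ 2 * ∫ y in (0 : ℝ)..1, ‖u y‖ ^ 2 := by
        gcongr
    _ = (1 / (2 * C₁)) ^ 2 * (B ^ 2 * ∫ y in (0 : ℝ)..1, ‖u y‖ ^ 2) := by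
        field_simp
    _ ≤ (1 / (2 * C₁)) ^ 2 * ((2 * C₁) ^ 2 * ∫ y in (0 : ℝ)..1, ‖F y‖ ^ 2) := by gcongr
    _ = ∫ y in (0 : ℝ)..1, ‖F y‖ ^ 2 := by field_simp

/-! ### Decay of a single mode -/

/-- `u` is a classical solution of the equation `∂_t u + i κ b u - ν ∂_y² u = 0` of a single Fourier
mode on `(0, ∞) × [0, 1]`, with the derivatives `ut`, `uy`, `uyy`. -/
structure IsModeSolution (bc : BoundaryCondition) (b : ℝ → ℝ) (κ ν : ℝ)
    (u ut uy uyy : ℝ → ℝ → ℂ) : Prop where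
  cont : ContinuousOn (Function.uncurry u) (Ioi 0 ×ˢ Icc 0 1)
  cont_t : ContinuousOn (Function.uncurry ut) (Ioi 0 ×ˢ Icc 0 1)
  cont_y : ContinuousOn (Function.uncurry uy) (Ioi 0 ×ˢ Icc 0 1)
  cont_yy : ContinuousOn (Function.uncurry uyy) (Ioi 0 ×ˢ Icc 0 1)
  deriv_t : ∀ t > 0, ∀ y ∈ Icc (0 : ℝ) 1, HasDerivAt (fun s => u s y) (ut t y) t
  deriv_y : ∀ t > 0, ∀ y ∈ Ioo (0 : ℝ) 1, HasDerivAt (u t) (uy t y) y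
  deriv_yy : ∀ t > 0, ∀ y ∈ Ioo (0 : ℝ) 1, HasDerivAt (uy t) (uyy t y) y
  boundary : ∀ t > 0, bc.HoldsMode (u t) (uy t)
  equation : ∀ t > 0, ∀ y ∈ Ioo (0 : ℝ) 1,
    ut t y + Complex.I * (κ * b y : ℝ) * u t y - ν * uyy t y = 0

theorem _root_.ContinuousOn.slice_left {X Y Z : Type*} [TopologicalSpace X] [TopologicalSpace Y]
    [TopologicalSpace Z] {f : X → Y → Z} {A : Set X} {B : Set Y}
    (hf : ContinuousOn (Function.uncurry f) (A ×ˢ B)) {x : X} (hx : x ∈ A) :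
    ContinuousOn (f x) B :=
  hf.comp (f := fun y => (x, y)) (by fun_prop) fun _ hy => ⟨hx, hy⟩

theorem _root_.ContinuousOn.swap_uncurry {X Y Z : Type*} [TopologicalSpace X] [TopologicalSpace Y]
    [TopologicalSpace Z] {f : X → Y → Z} {A : Set X} {B : Set Y}
    (hf : ContinuousOn (Function.uncurry f) (A ×ˢ B)) :
    ContinuousOn (Function.uncurry fun y x => f x y) (B ×ˢ A) :=
  hf.comp (f := Prod.swap) continuous_swap.continuousOn fun _ hy => ⟨hy.2, hy.1⟩

namespace IsModeSolution

variable {bc : BoundaryCondition} {b : ℝ → ℝ} {κ ν : ℝ} {u ut uy uyy : ℝ → ℝ → ℂ}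

theorem isC2 (hu : IsModeSolution bc b κ ν u ut uy uyy) {t : ℝ} (ht : 0 < t) :
    IsC2 (u t) (uy t) (uyy t) where
  cont := hu.cont.slice_left ht
  cont' := hu.cont_y.slice_left ht
  cont'' := hu.cont_yy.slice_left ht
  deriv := hu.deriv_y t ht
  deriv' := hu.deriv_yy t ht

theorem continuousOn_modeEnergy (hu : IsModeSolution bc b κ ν u ut uy uyy) :
    ContinuousOn (fun t => modeEnergy (u t)) (Ioi 0) :=
  continuousOn_parametric_intervalIntegral (G := fun t y => ‖u t y‖ ^ 2) zero_le_one
    (hu.cont.norm.pow 2)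

/-- The energy identity makes the energy of a mode nonincreasing. -/
theorem antitoneOn_modeEnergy (hu : IsModeSolution bc b κ ν u ut uy uyy) (hν : 0 ≤ ν) :
    AntitoneOn (fun t => modeEnergy (u t)) (Ioi 0) := by
  have hconj : ContinuousOn (fun p : ℝ × ℝ => conj (Function.uncurry u p)) (Ioi 0 ×ˢ Icc 0 1) :=
    Complex.continuous_conj.comp_continuousOn hu.cont
  have hsq : ContinuousOn (Function.uncurry fun t y => ‖u t y‖ ^ 2) (Ioi 0 ×ˢ Icc 0 1) :=
    hu.cont.norm.pow 2
  have hderiv : ∀ t ∈ Ioi (0 : ℝ), HasDerivAt (fun t => modeEnergy (u t))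
      (∫ y in (0 : ℝ)..1, 2 * (ut t y * conj (u t y)).re) t := by
    intro t ht
    refine hasDerivAt_parametric_intervalIntegral (G := fun t y => ‖u t y‖ ^ 2)
      (G' := fun t y => 2 * (ut t y * conj (u t y)).re) isOpen_Ioi zero_le_one hsq
      ((Complex.continuous_re.comp_continuousOn (hu.cont_t.mul hconj)).const_mul 2) ?_ ht
    intro s hs y hy
    refine (hu.deriv_t s hs y hy).norm_sq.congr_deriv ?_
    rw [Complex.inner]
  refine antitoneOn_of_deriv_nonpos (convex_Ioi 0) hu.continuousOn_modeEnergy ?_ ?_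
  · rw [interior_Ioi]
    exact fun t ht => (hderiv t ht).differentiableAt.differentiableWithinAt
  · rw [interior_Ioi]
    intro t ht
    rw [(hderiv t ht).deriv]
    have hEq : ∫ y in (0 : ℝ)..1, 2 * (ut t y * conj (u t y)).re =
        ∫ y in (0 : ℝ)..1, 2 * ν * (uyy t y * conj (u t y)).re := by
      refine intervalIntegral.integral_congr_Ioo_of_le zero_le_one fun y hy => ?_
      have h1 : ut t y = ν * uyy t y - Complex.I * (κ * b y : ℝ) * u t y := by
        linear_combination hu.equation t ht y hy
      simp only [h1]
      simp
      ring
    rw [hEq, intervalIntegral.integral_const_mul,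
      (hu.isC2 ht).integral_re_deriv2_mul_conj (hu.boundary t ht)]
    have : 0 ≤ ∫ y in (0 : ℝ)..1, ‖uy t y‖ ^ 2 :=
      intervalIntegral.integral_nonneg zero_le_one fun _ _ => by positivity
    nlinarith [mul_nonneg hν this]

/-- A resolvent bound on the imaginary axis bounds the space-time norm of `χ u` by that of `χ' u`,
by Parseval's identity in time. -/
theorem resolvent_in_time (hu : IsModeSolution bc b κ ν u ut uy uyy) {Ψ t₀ S : ℝ}
    (ht₀ : 0 < t₀) (hS : 0 < S)
    (hres : ResolventBound bc b κ ν Ψ)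
    {χ χ' : ℝ → ℝ} (hχ : ∀ s, HasDerivAt χ (χ' s) s) (hχ' : Continuous χ')
    (h0 : χ t₀ = 0) (h1 : χ (t₀ + S) = 0) :
    Ψ ^ 2 * ∫ s in t₀..(t₀ + S), χ s ^ 2 * modeEnergy (u s) ≤
      ∫ s in t₀..(t₀ + S), χ' s ^ 2 * modeEnergy (u s) := by
  have hab : t₀ < t₀ + S := by linarith
  have hχc : Continuous χ := continuous_iff_continuousAt.2 fun s => (hχ s).continuousAt
  have hI : Icc t₀ (t₀ + S) ⊆ Ioi 0 := fun s hs => ht₀.trans_le hs.1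
  -- joint continuity of a weight in time times a function on space-time
  have hw : ∀ {w : ℝ → ℝ} {g : ℝ → ℝ → ℂ}, Continuous w →
      ContinuousOn (Function.uncurry g) (Ioi 0 ×ˢ Icc 0 1) →
      ContinuousOn (Function.uncurry fun y s => (w s : ℂ) * g s y)
        (Icc 0 1 ×ˢ Icc t₀ (t₀ + S)) := by
    intro w g hwc hg
    have e : Continuous fun q : ℝ × ℝ => (w q.2 : ℂ) := by fun_prop
    exact e.continuousOn.mul (hg.swap_uncurry.mono (prod_mono subset_rfl hI))
  -- `T w g m` is the `m`-th Fourier coefficient in time of `w g`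
  let T : (ℝ → ℝ) → (ℝ → ℝ → ℂ) → ℤ → ℝ → ℂ := fun w g m y =>
    fourierCoeffOn hab (fun s => (w s : ℂ) * g s y) m
  have hTc : ∀ {w : ℝ → ℝ} {g : ℝ → ℝ → ℂ}, Continuous w →
      ContinuousOn (Function.uncurry g) (Ioi 0 ×ˢ Icc 0 1) → ∀ m,
      ContinuousOn (T w g m) (Icc 0 1) := fun hwc hg m =>
    continuousOn_fourierCoeffOn hab (hw hwc hg) m
  have hTd : ∀ {w : ℝ → ℝ} {g g' : ℝ → ℝ → ℂ}, Continuous w →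
      ContinuousOn (Function.uncurry g) (Ioi 0 ×ˢ Icc 0 1) →
      ContinuousOn (Function.uncurry g') (Ioi 0 ×ˢ Icc 0 1) →
      (∀ t > 0, ∀ y ∈ Ioo (0 : ℝ) 1, HasDerivAt (g t) (g' t y) y) →
      ∀ m, ∀ y ∈ Ioo (0 : ℝ) 1, HasDerivAt (T w g m) (T w g' m y) y := by
    intro w g g' hwc hg hg' hd m y hy
    have hsub : Ioo (0 : ℝ) 1 ×ˢ Icc t₀ (t₀ + S) ⊆ Icc 0 1 ×ˢ Icc t₀ (t₀ + S) :=
      prod_mono Ioo_subset_Icc_self subset_rfl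
    exact hasDerivAt_fourierCoeffOn isOpen_Ioo hab ((hw hwc hg).mono hsub)
      ((hw hwc hg').mono hsub) (fun z hz s hs => (hd s (hI hs) z hz).const_mul _) m hy
  have hTzero : ∀ (w : ℝ → ℝ) (g : ℝ → ℝ → ℂ) (y : ℝ) (m : ℤ), (∀ t > 0, g t y = 0) →
      T w g m y = 0 := by
    intro w g y m h
    have : T w g m y = fourierCoeffOn hab (fun s => (0 : ℂ) * g s y) m :=
      fourierCoeffOn_congr hab (fun s hs => by rw [h s (hI hs)]; simp) m
    rw [this, fourierCoeffOn.const_mul, zero_mul]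
  have hTeq : ∀ (w : ℝ → ℝ) (g : ℝ → ℝ → ℂ) (y z : ℝ) (m : ℤ), (∀ t > 0, g t y = g t z) →
      T w g m y = T w g m z := fun w g y z m h =>
    fourierCoeffOn_congr hab (fun s hs => by rw [h s (hI hs)]) m
  -- each Fourier coefficient solves the resolvent equation
  have hmode : ∀ m : ℤ, Ψ ^ 2 * modeEnergy (T χ u m) ≤ modeEnergy (T χ' u m) := by
    intro m
    refine hres (2 * Real.pi * m / ((t₀ + S) - t₀)) (T χ u m) (T χ uy m) (T χ uyy m) (T χ' u m)
      ⟨hTc hχc hu.cont m, hTc hχc hu.cont_y m, hTc hχc hu.cont_yy m,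
        hTd hχc hu.cont hu.cont_y hu.deriv_y m, hTd hχc hu.cont_y hu.cont_yy hu.deriv_yy m⟩ ?_
      (hTc hχ' hu.cont m) ?_
    · have hB := hu.boundary
      cases bc
      · exact ⟨hTeq _ _ _ _ _ fun t ht => (hB t ht).1, hTeq _ _ _ _ _ fun t ht => (hB t ht).2⟩
      · exact ⟨hTzero _ _ _ _ fun t ht => (hB t ht).1, hTzero _ _ _ _ fun t ht => (hB t ht).2⟩
      · exact ⟨hTzero _ _ _ _ fun t ht => (hB t ht).1, hTzero _ _ _ _ fun t ht => (hB t ht).2⟩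
    · intro y hy
      have hy' := Ioo_subset_Icc_self hy
      have c1 := (hw hχc hu.cont).slice_left hy'
      have c2 := (hw hχ' hu.cont).slice_left hy'
      have c3 := (hw hχc hu.cont_t).slice_left hy'
      have c4 := (hw hχc hu.cont_yy).slice_left hy'
      have e1 := fourierCoeffOn_deriv_of_eq hab (g := fun s => (χ s : ℂ) * u s y)
        (g' := fun s => (χ' s : ℂ) * u s y + (χ s : ℂ) * ut s y) c1 (c2.add c3)
        (fun s hs => (hχ s).ofReal_comp.mul
          (hu.deriv_t s (hI (Ioo_subset_Icc_self hs)) y hy')) (by simp [h0, h1]) m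
      have e2 : fourierCoeffOn hab (fun s => (χ s : ℂ) * ut s y) m =
          -(Complex.I * (κ * b y : ℝ)) * T χ u m y + ν * T χ uyy m y := by
        have : fourierCoeffOn hab (fun s => (χ s : ℂ) * ut s y) m =
            fourierCoeffOn hab (fun s => -(Complex.I * (κ * b y : ℝ)) * ((χ s : ℂ) * u s y) +
              ν * ((χ s : ℂ) * uyy s y)) m := by
          refine fourierCoeffOn_congr hab (fun s hs => ?_) m
          linear_combination (χ s : ℂ) * hu.equation s (hI hs) y hy
        rw [this, fourierCoeffOn_add hab (c1.const_mul _) (c4.const_mul _),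
          fourierCoeffOn.const_mul, fourierCoeffOn.const_mul]
      rw [fourierCoeffOn_add hab c2 c3, e2] at e1
      have e3 : T χ' u m y = fourierCoeffOn hab (fun s => (χ' s : ℂ) * u s y) m := rfl
      have e4 : T χ u m y = fourierCoeffOn hab (fun s => (χ s : ℂ) * u s y) m := rfl
      rw [← e3, ← e4] at e1
      push_cast at e1 ⊢
      linear_combination e1
  -- Parseval's identity
  have hpars : ∀ {w : ℝ → ℝ}, Continuous w →
      ∑' m : ℤ, ENNReal.ofReal (modeEnergy (T w u m)) =
        ENNReal.ofReal (S⁻¹ * ∫ s in t₀..(t₀ + S), w s ^ 2 * modeEnergy (u s)) := by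
    intro w hwc
    have hsq : ContinuousOn (Function.uncurry fun y s => ‖(w s : ℂ) * u s y‖ ^ 2)
        (Icc 0 1 ×ˢ Icc t₀ (t₀ + S)) := (hw hwc hu.cont).norm.pow 2
    have h2 := tsum_integral_sq_fourierCoeffOn hab (hw hwc hu.cont)
    rw [intervalIntegral_swap_of_continuousOn zero_le_one hab.le hsq, add_sub_cancel_left] at h2
    refine h2.trans ?_
    congr 2
    refine intervalIntegral.integral_congr fun s _ => ?_
    simp only [modeEnergy]
    rw [← intervalIntegral.integral_const_mul]
    refine intervalIntegral.integral_congr fun y _ => ?_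
    simp only [norm_mul, Complex.norm_real, mul_pow, Real.norm_eq_abs, sq_abs]
  have hle : ENNReal.ofReal (Ψ ^ 2) *
      ∑' m : ℤ, ENNReal.ofReal (modeEnergy (T χ u m)) ≤
        ∑' m : ℤ, ENNReal.ofReal (modeEnergy (T χ' u m)) := by
    rw [← ENNReal.tsum_mul_left]
    refine ENNReal.tsum_le_tsum fun m => ?_
    rw [← ENNReal.ofReal_mul (sq_nonneg _)]
    exact ENNReal.ofReal_le_ofReal (hmode m)
  rw [hpars hχc, hpars hχ', ← ENNReal.ofReal_mul (sq_nonneg _)] at hle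
  have hnn : 0 ≤ ∫ s in t₀..(t₀ + S), χ' s ^ 2 * modeEnergy (u s) :=
    intervalIntegral.integral_nonneg hab.le fun s _ =>
      mul_nonneg (sq_nonneg _) (modeEnergy_nonneg _)
  have hSi : 0 < S⁻¹ := inv_pos.2 hS
  have h3 := (ENNReal.ofReal_le_ofReal_iff (mul_nonneg hSi.le hnn)).1 hle
  refine le_of_mul_le_mul_left (a := S⁻¹) ?_ hSi
  linarith

/-- Over a time `6 / Ψ` the energy drops by a factor `e`. -/
theorem modeEnergy_add_le (hu : IsModeSolution bc b κ ν u ut uy uyy) (hν : 0 ≤ ν) {Ψ t₀ : ℝ}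
    (ht₀ : 0 < t₀) (hΨ : 0 < Ψ)
    (hres : ResolventBound bc b κ ν Ψ) :
    modeEnergy (u (t₀ + 6 / Ψ)) ≤ Real.exp (-1) * modeEnergy (u t₀) := by
  set S := 6 / Ψ with hSdef
  have hS : 0 < S := by positivity
  have hab : t₀ ≤ t₀ + S := by linarith
  have hanti := hu.antitoneOn_modeEnergy hν
  have hcE : ContinuousOn (fun s => modeEnergy (u s)) (Icc t₀ (t₀ + S)) :=
    hu.continuousOn_modeEnergy.mono fun s hs => ht₀.trans_le hs.1
  have hp1 : ContinuousOn (fun s : ℝ => ((s - t₀) * (t₀ + S - s)) ^ 2) (Icc t₀ (t₀ + S)) :=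
    Continuous.continuousOn (by fun_prop)
  have hp2 : ContinuousOn (fun s : ℝ => (2 * t₀ + S - 2 * s) ^ 2) (Icc t₀ (t₀ + S)) :=
    Continuous.continuousOn (by fun_prop)
  -- the cutoff is `χ(s) = (s - t₀) (t₀ + S - s)`
  have hχ : ∀ s : ℝ, HasDerivAt (fun s : ℝ => (s - t₀) * (t₀ + S - s)) (2 * t₀ + S - 2 * s) s := by
    intro s
    refine (((hasDerivAt_id s).sub_const t₀).mul
      ((hasDerivAt_id s).const_sub (t₀ + S))).congr_deriv ?_
    simp only [id]; ring
  have key := hu.resolvent_in_time ht₀ hS hres hχ (by fun_prop) (by simp) (by simp)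
  have hint1 : ∫ s in t₀..(t₀ + S), ((s - t₀) * (t₀ + S - s)) ^ 2 = S ^ 5 / 30 := by
    rw [intervalIntegral.integral_eq_sub_of_hasDerivAt_of_le hab
      (f := fun s => S ^ 2 * (s - t₀) ^ 3 / 3 - S * (s - t₀) ^ 4 / 2 + (s - t₀) ^ 5 / 5)
      (Continuous.continuousOn (by fun_prop)) (fun s _ => ?_)
      (hp1.intervalIntegrable_of_subset hab subset_rfl)]
    · ring
    · have h1 := (hasDerivAt_id s).sub_const t₀
      refine (((((h1.pow 3).const_mul (S ^ 2)).div_const 3).sub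
        (((h1.pow 4).const_mul S).div_const 2)).add ((h1.pow 5).div_const 5)).congr_deriv ?_
      simp only [id]; push_cast; ring
  have hint2 : ∫ s in t₀..(t₀ + S), (2 * t₀ + S - 2 * s) ^ 2 = S ^ 3 / 3 := by
    rw [intervalIntegral.integral_eq_sub_of_hasDerivAt_of_le hab
      (f := fun s => -(2 * t₀ + S - 2 * s) ^ 3 / 6)
      (Continuous.continuousOn (by fun_prop)) (fun s _ => ?_)
      (hp2.intervalIntegrable_of_subset hab subset_rfl)]
    · ring
    · have h1 := ((hasDerivAt_id s).const_mul 2).const_sub (2 * t₀ + S)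
      refine (((h1.pow 3).neg).div_const 6).congr_deriv ?_
      simp only [id]; push_cast; ring
  have hlow : S ^ 5 / 30 * modeEnergy (u (t₀ + S)) ≤
      ∫ s in t₀..(t₀ + S), ((s - t₀) * (t₀ + S - s)) ^ 2 * modeEnergy (u s) := by
    rw [← hint1, ← intervalIntegral.integral_mul_const]
    refine intervalIntegral.integral_mono_on hab
      ((hp1.mul continuousOn_const).intervalIntegrable_of_subset hab subset_rfl)
      ((hp1.mul hcE).intervalIntegrable_of_subset hab subset_rfl) fun s hs => ?_
    exact mul_le_mul_of_nonneg_left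
      (hanti (ht₀.trans_le hs.1) (by simp only [mem_Ioi]; linarith) hs.2) (sq_nonneg _)
  have hup : ∫ s in t₀..(t₀ + S), (2 * t₀ + S - 2 * s) ^ 2 * modeEnergy (u s) ≤
      S ^ 3 / 3 * modeEnergy (u t₀) := by
    rw [← hint2, ← intervalIntegral.integral_mul_const]
    refine intervalIntegral.integral_mono_on hab
      ((hp2.mul hcE).intervalIntegrable_of_subset hab subset_rfl)
      ((hp2.mul continuousOn_const).intervalIntegrable_of_subset hab subset_rfl) fun s hs => ?_
    exact mul_le_mul_of_nonneg_left (hanti ht₀ (ht₀.trans_le hs.1) hs.1) (sq_nonneg _)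
  have hΨS : Ψ ^ 2 * S ^ 2 = 36 := by rw [hSdef]; field_simp; norm_num
  have h3 : S ^ 3 * (36 / 30 * modeEnergy (u (t₀ + S))) ≤
      S ^ 3 * (1 / 3 * modeEnergy (u t₀)) := by
    calc S ^ 3 * (36 / 30 * modeEnergy (u (t₀ + S)))
        = Ψ ^ 2 * (S ^ 5 / 30 * modeEnergy (u (t₀ + S))) := by rw [← hΨS]; ring
      _ ≤ S ^ 3 / 3 * modeEnergy (u t₀) :=
          (mul_le_mul_of_nonneg_left hlow (sq_nonneg Ψ)).trans (key.trans hup)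
      _ = _ := by ring
  have h4 := le_of_mul_le_mul_left h3 (by positivity)
  -- `10 / (Ψ S)² = 10 / 36` is below `1 / e`
  have hexp : (10 / 36 : ℝ) ≤ Real.exp (-1) := by
    rw [Real.exp_neg, ← one_div, le_div_iff₀ (Real.exp_pos 1)]
    linarith [Real.exp_one_lt_d9]
  have h5 := mul_le_mul_of_nonneg_right hexp (modeEnergy_nonneg (u t₀))
  linarith

/-- Exponential decay of the energy of a mode at the rate given by the resolvent bound. -/
theorem modeEnergy_le_exp (hu : IsModeSolution bc b κ ν u ut uy uyy) (hν : 0 ≤ ν) {Ψ t₀ t : ℝ}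
    (ht₀ : 0 < t₀) (ht : t₀ ≤ t) (hΨ : 0 < Ψ)
    (hres : ResolventBound bc b κ ν Ψ) :
    modeEnergy (u t) ≤ Real.exp (1 - Ψ / 6 * (t - t₀)) * modeEnergy (u t₀) := by
  have hiter : ∀ n : ℕ, modeEnergy (u (t₀ + n * (6 / Ψ))) ≤
      Real.exp (-n) * modeEnergy (u t₀) := by
    intro n
    induction n with
    | zero => simp
    | succ n ih =>
      have h1 := hu.modeEnergy_add_le hν (t₀ := t₀ + n * (6 / Ψ)) (by positivity) hΨ hres
      have e : t₀ + ((n + 1 : ℕ) : ℝ) * (6 / Ψ) = t₀ + n * (6 / Ψ) + 6 / Ψ := by push_cast; ring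
      rw [e]
      refine h1.trans ((mul_le_mul_of_nonneg_left ih (Real.exp_pos _).le).trans_eq ?_)
      rw [← mul_assoc, ← Real.exp_add]
      push_cast
      ring_nf
  set n := ⌊Ψ / 6 * (t - t₀)⌋₊ with hn
  have hx : 0 ≤ Ψ / 6 * (t - t₀) := mul_nonneg (by positivity) (by linarith)
  have h1 : (n : ℝ) ≤ Ψ / 6 * (t - t₀) := Nat.floor_le hx
  have h2 : Ψ / 6 * (t - t₀) < n + 1 := Nat.lt_floor_add_one _
  have h3 : t₀ + n * (6 / Ψ) ≤ t := by
    have : n * (6 / Ψ) ≤ Ψ / 6 * (t - t₀) * (6 / Ψ) := by gcongr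
    have e : Ψ / 6 * (t - t₀) * (6 / Ψ) = t - t₀ := by field_simp
    linarith
  have hanti := hu.antitoneOn_modeEnergy hν
  have h4 := hanti (a := t₀ + n * (6 / Ψ)) (b := t)
    (by simp only [mem_Ioi]; positivity) (by simp only [mem_Ioi]; linarith) h3
  refine h4.trans ((hiter n).trans ?_)
  have := modeEnergy_nonneg (u t₀)
  gcongr
  linarith

end IsModeSolution

/-! ### Fourier modes of solutions -/

/-- The closed space-time domain `(0, ∞) × Ω̄` with coordinates `(t, (x, y))`. -/
def spaceTime (D : CrossSection) : Set (ℝ × ℝ × ℝ) := Ioi 0 ×ˢ (univ ×ˢ D.closed)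

theorem uniqueDiffOn_spaceTime (D : CrossSection) : UniqueDiffOn ℝ (spaceTime D) :=
  (uniqueDiffOn_Ioi 0).prod (uniqueDiffOn_univ.prod D.uniqueDiffOn_closed)

/-- The directional derivative along `v` within space-time. -/
noncomputable def dirDeriv (D : CrossSection) (v : ℝ × ℝ × ℝ) (G : ℝ × ℝ × ℝ → ℝ)
    (p : ℝ × ℝ × ℝ) : ℝ :=
  fderivWithin ℝ G (spaceTime D) p v

section Derivatives

variable {D : CrossSection} {G : ℝ × ℝ × ℝ → ℝ}

theorem contDiffOn_dirDeriv (hG : ContDiffOn ℝ ∞ G (spaceTime D)) (v : ℝ × ℝ × ℝ) :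
    ContDiffOn ℝ ∞ (dirDeriv D v G) (spaceTime D) :=
  (hG.fderivWithin (uniqueDiffOn_spaceTime D) (by simp)).clm_apply contDiffOn_const

theorem hasFDerivWithinAt_spaceTime (hG : ContDiffOn ℝ ∞ G (spaceTime D)) {p : ℝ × ℝ × ℝ}
    (hp : p ∈ spaceTime D) :
    HasFDerivWithinAt G (fderivWithin ℝ G (spaceTime D) p) (spaceTime D) p :=
  (hG.differentiableOn (by simp) p hp).hasFDerivWithinAt

theorem hasDerivAt_t (hG : ContDiffOn ℝ ∞ G (spaceTime D)) {t x y : ℝ} (ht : 0 < t)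
    (hy : y ∈ D.closed) :
    HasDerivAt (fun s => G (s, x, y)) (dirDeriv D (1, 0, 0) G (t, x, y)) t := by
  have h1 : HasDerivWithinAt (fun s : ℝ => (s, x, y)) (1, 0, 0) (Ioi 0) t :=
    ((hasDerivAt_id t).prodMk (hasDerivAt_const t (x, y))).hasDerivWithinAt
  have h2 := (hasFDerivWithinAt_spaceTime hG
    (p := (t, x, y)) ⟨ht, mem_univ _, hy⟩).comp_hasDerivWithinAt t h1
    (show MapsTo _ (Ioi 0) (spaceTime D) from fun s hs => ⟨hs, mem_univ _, hy⟩)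
  exact h2.hasDerivAt (Ioi_mem_nhds ht)

theorem hasDerivAt_x (hG : ContDiffOn ℝ ∞ G (spaceTime D)) {t x y : ℝ} (ht : 0 < t)
    (hy : y ∈ D.closed) :
    HasDerivAt (fun x => G (t, x, y)) (dirDeriv D (0, 1, 0) G (t, x, y)) x := by
  have h1 : HasDerivWithinAt (fun x : ℝ => (t, x, y)) (0, 1, 0) univ x :=
    ((hasDerivAt_const x t).prodMk
      ((hasDerivAt_id x).prodMk (hasDerivAt_const x y))).hasDerivWithinAt
  have h2 := (hasFDerivWithinAt_spaceTime hG
    (p := (t, x, y)) ⟨ht, mem_univ _, hy⟩).comp_hasDerivWithinAt x h1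
    (show MapsTo _ univ (spaceTime D) from fun s _ => ⟨ht, mem_univ _, hy⟩)
  exact h2.hasDerivAt univ_mem

theorem hasDerivWithinAt_y (hG : ContDiffOn ℝ ∞ G (spaceTime D)) {t x y : ℝ} (ht : 0 < t)
    (hy : y ∈ D.closed) :
    HasDerivWithinAt (fun y => G (t, x, y)) (dirDeriv D (0, 0, 1) G (t, x, y)) D.closed y := by
  have h1 : HasDerivWithinAt (fun y : ℝ => (t, x, y)) (0, 0, 1) D.closed y :=
    ((hasDerivAt_const y t).prodMk
      ((hasDerivAt_const y x).prodMk (hasDerivAt_id y))).hasDerivWithinAt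
  exact (hasFDerivWithinAt_spaceTime hG
    (p := (t, x, y)) ⟨ht, mem_univ _, hy⟩).comp_hasDerivWithinAt y h1
    (show MapsTo _ D.closed (spaceTime D) from fun s hs => ⟨ht, mem_univ _, hs⟩)

theorem hasDerivAt_y (hG : ContDiffOn ℝ ∞ G (spaceTime D)) {t x y : ℝ} (ht : 0 < t)
    (hy : y ∈ Ioo (0 : ℝ) 1) :
    HasDerivAt (fun y => G (t, x, y)) (dirDeriv D (0, 0, 1) G (t, x, y)) y :=
  (hasDerivWithinAt_y hG ht (D.Icc_subset_closed (Ioo_subset_Icc_self hy))).hasDerivAt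
    (mem_of_superset (Icc_mem_nhds hy.1 hy.2) D.Icc_subset_closed)

end Derivatives

/-- The `k`-th Fourier coefficient in `x` of a function on space-time. -/
noncomputable def xMode (k : ℤ) (G : ℝ × ℝ × ℝ → ℝ) (t y : ℝ) : ℂ :=
  xFourier (fun q => G (t, q)) k y

section Modes

variable {D : CrossSection} {G : ℝ × ℝ × ℝ → ℝ}

theorem continuousOn_complexified (hG : ContinuousOn G (spaceTime D)) :
    ContinuousOn (Function.uncurry fun (p : ℝ × ℝ) (x : ℝ) => (G (p.1, x, p.2) : ℂ))
      ((Ioi 0 ×ˢ Icc 0 1) ×ˢ Icc 0 1) :=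
  Complex.continuous_ofReal.comp_continuousOn
    (hG.comp (f := fun q : (ℝ × ℝ) × ℝ => (q.1.1, q.2, q.1.2)) (by fun_prop)
      fun _ hq => ⟨hq.1.1, mem_univ _, D.Icc_subset_closed hq.1.2⟩)

theorem continuousOn_xMode (hG : ContinuousOn G (spaceTime D)) (k : ℤ) :
    ContinuousOn (Function.uncurry (xMode k G)) (Ioi 0 ×ˢ Icc 0 1) :=
  continuousOn_fourierCoeffOn zero_lt_one (continuousOn_complexified hG) k

theorem continuousOn_complexified_slice_t (hG : ContinuousOn G (spaceTime D)) {y : ℝ}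
    (hy : y ∈ Icc (0 : ℝ) 1) :
    ContinuousOn (Function.uncurry fun (t x : ℝ) => (G (t, x, y) : ℂ))
      (Ioi 0 ×ˢ Icc 0 1) :=
  (continuousOn_complexified hG).comp (f := fun q : ℝ × ℝ => ((q.1, y), q.2)) (by fun_prop)
    fun _ hq => ⟨⟨hq.1, hy⟩, hq.2⟩

theorem continuousOn_complexified_slice_y (hG : ContinuousOn G (spaceTime D)) {t : ℝ}
    (ht : 0 < t) :
    ContinuousOn (Function.uncurry fun (y x : ℝ) => (G (t, x, y) : ℂ))
      (Icc 0 1 ×ˢ Icc 0 1) :=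
  (continuousOn_complexified hG).comp (f := fun q : ℝ × ℝ => ((t, q.1), q.2)) (by fun_prop)
    fun _ hq => ⟨⟨ht, hq.1⟩, hq.2⟩

theorem hasDerivAt_xMode_t (hG : ContDiffOn ℝ ∞ G (spaceTime D)) (k : ℤ) {t y : ℝ} (ht : 0 < t)
    (hy : y ∈ Icc (0 : ℝ) 1) :
    HasDerivAt (fun s => xMode k G s y) (xMode k (dirDeriv D (1, 0, 0) G) t y) t :=
  hasDerivAt_fourierCoeffOn isOpen_Ioi zero_lt_one
    (continuousOn_complexified_slice_t hG.continuousOn hy)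
    (continuousOn_complexified_slice_t (contDiffOn_dirDeriv hG _).continuousOn hy)
    (fun _ hs _ _ => (hasDerivAt_t hG hs (D.Icc_subset_closed hy)).ofReal_comp) k ht

theorem hasDerivAt_xMode_y (hG : ContDiffOn ℝ ∞ G (spaceTime D)) (k : ℤ) {t y : ℝ} (ht : 0 < t)
    (hy : y ∈ Ioo (0 : ℝ) 1) :
    HasDerivAt (xMode k G t) (xMode k (dirDeriv D (0, 0, 1) G) t y) y := by
  have hsub : Ioo (0 : ℝ) 1 ×ˢ Icc (0 : ℝ) 1 ⊆ Icc 0 1 ×ˢ Icc 0 1 :=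
    prod_mono Ioo_subset_Icc_self subset_rfl
  exact hasDerivAt_fourierCoeffOn isOpen_Ioo zero_lt_one
    ((continuousOn_complexified_slice_y hG.continuousOn ht).mono hsub)
    ((continuousOn_complexified_slice_y (contDiffOn_dirDeriv hG _).continuousOn ht).mono hsub)
    (fun _ hz _ _ => (hasDerivAt_y hG ht hz).ofReal_comp) k hy

theorem xMode_dirDeriv_x (hG : ContDiffOn ℝ ∞ G (spaceTime D)) (k : ℤ) {t y : ℝ} (ht : 0 < t)
    (hy : y ∈ Icc (0 : ℝ) 1) (hper : G (t, 0, y) = G (t, 1, y)) :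
    xMode k (dirDeriv D (0, 1, 0) G) t y =
      Complex.I * (2 * Real.pi * k : ℝ) * xMode k G t y := by
  have h := fourierCoeffOn_deriv_of_eq (zero_lt_one : (0 : ℝ) < 1)
    (g := fun x => (G (t, x, y) : ℂ)) (g' := fun x => (dirDeriv D (0, 1, 0) G (t, x, y) : ℂ))
    ((continuousOn_complexified_slice_t hG.continuousOn hy).slice_left ht)
    ((continuousOn_complexified_slice_t (contDiffOn_dirDeriv hG _).continuousOn hy).slice_left ht)
    (fun x _ => (hasDerivAt_x hG ht (D.Icc_subset_closed hy)).ofReal_comp) (by rw [hper]) k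
  rwa [sub_zero, div_one] at h

end Modes

theorem xFourier_eq_zero {g : ℝ × ℝ → ℝ} {y : ℝ} (h : ∀ x, g (x, y) = 0) (k : ℤ) :
    xFourier g k y = 0 := by
  have : xFourier g k y = fourierCoeffOn (zero_lt_one : (0 : ℝ) < 1)
      (fun x => (0 : ℂ) * (g (x, y) : ℂ)) k :=
    fourierCoeffOn_congr _ (fun x _ => by rw [h x]; simp) k
  rw [this, fourierCoeffOn.const_mul, zero_mul]

theorem xFourier_congr {g₁ g₂ : ℝ × ℝ → ℝ} {y z : ℝ} (h : ∀ x, g₁ (x, y) = g₂ (x, z)) (k : ℤ) :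
    xFourier g₁ k y = xFourier g₂ k z :=
  fourierCoeffOn_congr _ (fun x _ => by rw [h x]) k

/-- Each Fourier mode of a solution solves the one-dimensional equation with frequency
`κ = 2πk`. -/
theorem IsSolution.isModeSolution {bc : BoundaryCondition} {b : ℝ → ℝ} {ν : ℝ}
    {f_in : ℝ × ℝ → ℝ} {f : ℝ → ℝ × ℝ → ℝ} (hf : IsSolution bc b ν f_in f) (k : ℤ) :
    let G := Function.uncurry f
    let D := bc.crossSection
    IsModeSolution bc b (2 * Real.pi * k) ν (xMode k G) (xMode k (dirDeriv D (1, 0, 0) G))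
      (xMode k (dirDeriv D (0, 0, 1) G))
      (xMode k (dirDeriv D (0, 0, 1) (dirDeriv D (0, 0, 1) G))) := by
  intro G D
  have hG : ContDiffOn ℝ ∞ G (spaceTime D) := hf.smooth
  have hGt := contDiffOn_dirDeriv hG (1, 0, 0)
  have hGx := contDiffOn_dirDeriv hG (0, 1, 0)
  have hGy := contDiffOn_dirDeriv hG (0, 0, 1)
  have hGyy := contDiffOn_dirDeriv hGy (0, 0, 1)
  refine ⟨continuousOn_xMode hG.continuousOn k, continuousOn_xMode hGt.continuousOn k,
    continuousOn_xMode hGy.continuousOn k, continuousOn_xMode hGyy.continuousOn k,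
    fun t ht y hy => hasDerivAt_xMode_t hG k ht hy,
    fun t ht y hy => hasDerivAt_xMode_y hG k ht hy,
    fun t ht y hy => hasDerivAt_xMode_y hGy k ht hy, fun t ht => ?_, fun t ht y hy => ?_⟩
  · have hB := hf.boundary t ht
    cases bc with
    | periodic =>
      refine ⟨xFourier_congr (fun x => ?_) k, xFourier_congr (fun x => ?_) k⟩
      · have := hB x 0
        rw [zero_add] at this
        exact this
      · have hd : ∀ y : ℝ, HasDerivAt (fun y => G (t, x, y))
            (dirDeriv D (0, 0, 1) G (t, x, y)) y := fun y =>
          (hasDerivWithinAt_y hG ht (mem_univ y)).hasDerivAt univ_mem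
        have h1 : HasDerivAt (fun y => G (t, x, y + 1)) (dirDeriv D (0, 0, 1) G (t, x, 1)) 0 := by
          have := hd (0 + 1)
          rw [show (t, x, (1 : ℝ)) = (t, x, (0 : ℝ) + 1) by simp]
          exact this.comp_add_const 0 1
        have h2 : (fun y => G (t, x, y + 1)) = fun y => G (t, x, y) := funext (hB x)
        rw [h2] at h1
        exact h1.unique (hd 0)
    | dirichlet =>
      exact ⟨xFourier_eq_zero (fun x => (hB x).1) k, xFourier_eq_zero (fun x => (hB x).2) k⟩
    | neumann =>
      have hd : ∀ (x : ℝ), ∀ y ∈ Icc (0 : ℝ) 1,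
          dirDeriv D (0, 0, 1) G (t, x, y) = derivWithin (fun y => f t (x, y)) (Icc 0 1) y :=
        fun x y hy => ((hasDerivWithinAt_y hG ht hy).derivWithin
          (uniqueDiffOn_Icc zero_lt_one y hy)).symm
      exact ⟨xFourier_eq_zero (fun x => (hd x 0 (by simp)).trans (hB x).1) k,
        xFourier_eq_zero (fun x => (hd x 1 (by simp)).trans (hB x).2) k⟩
  · have hy' := Ioo_subset_Icc_self hy
    have hyD : y ∈ D.closed := D.Icc_subset_closed hy'
    have hU : UniqueDiffOn ℝ D.closed := D.uniqueDiffOn_closed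
    have hpde : ∀ x : ℝ, dirDeriv D (1, 0, 0) G (t, x, y) =
        -b y * dirDeriv D (0, 1, 0) G (t, x, y) +
          ν * dirDeriv D (0, 0, 1) (dirDeriv D (0, 0, 1) G) (t, x, y) := by
      intro x
      have e1 : deriv (fun s => f s (x, y)) t = dirDeriv D (1, 0, 0) G (t, x, y) :=
        (hasDerivAt_t hG ht hyD).deriv
      have e2 : deriv (fun x' => f t (x', y)) x = dirDeriv D (0, 1, 0) G (t, x, y) :=
        (hasDerivAt_x hG ht hyD).deriv
      have e3 : iteratedDerivWithin 2 (fun y' => f t (x, y')) D.closed y =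
          dirDeriv D (0, 0, 1) (dirDeriv D (0, 0, 1) G) (t, x, y) := by
        rw [iteratedDerivWithin_succ, iteratedDerivWithin_one]
        have h1 : EqOn (derivWithin (fun y' => f t (x, y')) D.closed)
            (fun y' => dirDeriv D (0, 0, 1) G (t, x, y')) D.closed := fun z hz =>
          (hasDerivWithinAt_y hG ht hz).derivWithin (hU z hz)
        rw [derivWithin_congr h1 (h1 hyD)]
        exact (hasDerivWithinAt_y hGy ht hyD).derivWithin (hU y hyD)
      have := hf.equation t ht x y hyD
      rw [e1, e2, e3] at this
      linarith
    have cx := (continuousOn_complexified_slice_t hGx.continuousOn hy').slice_left ht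
    have cyy := (continuousOn_complexified_slice_t hGyy.continuousOn hy').slice_left ht
    have e : xMode k (dirDeriv D (1, 0, 0) G) t y =
        -(b y : ℂ) * xMode k (dirDeriv D (0, 1, 0) G) t y +
          ν * xMode k (dirDeriv D (0, 0, 1) (dirDeriv D (0, 0, 1) G)) t y := by
      have h1 : xMode k (dirDeriv D (1, 0, 0) G) t y =
          fourierCoeffOn (zero_lt_one : (0 : ℝ) < 1) (fun x =>
            -(b y : ℂ) * (dirDeriv D (0, 1, 0) G (t, x, y) : ℂ) +
            ν * (dirDeriv D (0, 0, 1) (dirDeriv D (0, 0, 1) G) (t, x, y) : ℂ)) k :=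
        fourierCoeffOn_congr _ (fun x _ => by simp only [hpde x]; push_cast; ring) k
      rw [h1, fourierCoeffOn_add _ (cx.const_mul _) (cyy.const_mul _), fourierCoeffOn.const_mul,
        fourierCoeffOn.const_mul]
      rfl
    have hper : G (t, 0, y) = G (t, 1, y) := by
      have := hf.periodic_x t ht 0 y hyD
      rw [zero_add] at this
      exact this.symm
    rw [e, xMode_dirDeriv_x hG k ht hy' hper]
    push_cast
    ring

/-! ### Gevrey norms and summation over the modes -/

instance : IsFiniteMeasure volΩ := by
  unfold volΩ
  refine ⟨?_⟩
  rw [Measure.restrict_apply_univ, Measure.volume_eq_prod, Measure.prod_prod]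
  simp

/-- Parseval's identity in `x` on the channel. -/
theorem tsum_modeEnergy_xFourier {g : ℝ × ℝ → ℝ} (hg : ContinuousOn g (Icc 0 1 ×ˢ Icc 0 1)) :
    ∑' k : ℤ, ENNReal.ofReal (modeEnergy (xFourier g k)) = eLpNorm g 2 volΩ ^ 2 := by
  have hgc : ContinuousOn (Function.uncurry fun y x : ℝ => (g (x, y) : ℂ))
      (Icc 0 1 ×ˢ Icc 0 1) :=
    Complex.continuous_ofReal.comp_continuousOn
      (hg.comp continuous_swap.continuousOn fun _ hq => ⟨hq.2, hq.1⟩)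
  have hsq : ContinuousOn (Function.uncurry fun y x : ℝ => ‖(g (x, y) : ℂ)‖ ^ 2)
      (Icc 0 1 ×ˢ Icc 0 1) := hgc.norm.pow 2
  have h := tsum_integral_sq_fourierCoeffOn (zero_lt_one : (0 : ℝ) < 1) hgc
  rw [intervalIntegral_swap_of_continuousOn zero_le_one zero_le_one hsq] at h
  refine h.trans ?_
  have hint : IntegrableOn (fun z => ‖g z‖ ^ 2) (Ioo 0 1 ×ˢ Ioo 0 1) :=
    ((hg.norm.pow 2).integrableOn_compact (isCompact_Icc.prod isCompact_Icc)).mono_set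
      (prod_mono Ioo_subset_Icc_self Ioo_subset_Icc_self)
  have e1 : ((1 : ℝ) - 0)⁻¹ * ∫ x in (0 : ℝ)..1, ∫ y in (0 : ℝ)..1, ‖(g (x, y) : ℂ)‖ ^ 2 =
      ∫ z, ‖g z‖ ^ 2 ∂volΩ := by
    rw [volΩ, Measure.volume_eq_prod, setIntegral_prod _ hint]
    simp only [intervalIntegral.integral_of_le zero_le_one, integral_Ioc_eq_integral_Ioo,
      Complex.norm_real, sub_zero, inv_one, one_mul]
  have hint' : Integrable (fun z => ‖g z‖ ^ 2) volΩ := hint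
  rw [e1, ofReal_integral_eq_lintegral_ofReal hint' (ae_of_all _ fun z => by positivity)]
  have e2 : eLpNorm g 2 volΩ ^ 2 = ∫⁻ z, ‖g z‖ₑ ^ 2 ∂volΩ := by
    simpa using eLpNorm_nnreal_pow_eq_lintegral (f := g) (μ := volΩ) (p := 2) two_ne_zero
  rw [e2]
  refine lintegral_congr fun z => ?_
  rw [ENNReal.ofReal_pow (norm_nonneg _), ofReal_norm]

theorem gevreyNorm_eq {a p : ℝ} {g : ℝ × ℝ → ℝ}
    (hg : ∀ k : ℤ, ContinuousOn (xFourier g k) (Icc 0 1)) :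
    gevreyNorm a p g = (∑' k : ℤ, ENNReal.ofReal
      (Real.exp (a * (2 * Real.pi * |(k : ℝ)|) ^ (1 / p)) ^ 2 * modeEnergy (xFourier g k)))
        ^ (1 / 2 : ℝ) := by
  unfold gevreyNorm
  congr 1
  refine tsum_congr fun k => ?_
  have hc : ContinuousOn (fun y =>
      (Real.exp (a * (2 * Real.pi * |(k : ℝ)|) ^ (1 / p)) : ℂ) * xFourier g k y) (Icc 0 1) :=
    continuousOn_const.mul (hg k)
  rw [restrict_Ioo_eq_restrict_Ioc, ← ofReal_integral_normSq zero_le_one hc, modeEnergy,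
    ← intervalIntegral.integral_const_mul]
  congr 1
  refine intervalIntegral.integral_congr fun y _ => ?_
  simp only [norm_mul, Complex.norm_real, Real.norm_eq_abs, mul_pow, sq_abs]

/-- The scale `δ = (ν / K) ^ (1 / (N + 3))` at which shear and diffusion balance. -/
theorem exists_balance_scale (N : ℕ) {ν K r : ℝ} (hν : 0 < ν) (hK : 1 ≤ K) (hr : 0 < r)
    (hνr : ν < r ^ (N + 3)) :
    ∃ δ : ℝ, 0 < δ ∧ δ ≤ r ∧ ν = K * δ ^ (N + 3) ∧
      K * δ ^ (N + 1) =
        ν ^ (((N : ℝ) + 1) / ((N : ℝ) + 3)) * K ^ (2 / ((N : ℝ) + 3)) := by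
  have hK0 : 0 < K := by linarith
  have hN : (0 : ℝ) < (N : ℝ) + 3 := by positivity
  have hq : 0 < ν / K := by positivity
  have e1 : ((ν / K) ^ (1 / ((N : ℝ) + 3))) ^ (N + 3) = ν / K := by
    rw [← Real.rpow_natCast, ← Real.rpow_mul hq.le]
    push_cast
    rw [one_div_mul_cancel hN.ne', Real.rpow_one]
  have e2 : ((ν / K) ^ (1 / ((N : ℝ) + 3))) ^ (N + 1) =
      (ν / K) ^ (((N : ℝ) + 1) / ((N : ℝ) + 3)) := by
    rw [← Real.rpow_natCast, ← Real.rpow_mul hq.le]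
    push_cast
    congr 1
    ring
  refine ⟨(ν / K) ^ (1 / ((N : ℝ) + 3)), by positivity, ?_, ?_, ?_⟩
  · refine le_of_pow_le_pow_left₀ (n := N + 3) (by omega) hr.le ?_
    rw [e1]
    exact (div_le_self hν.le hK).trans hνr.le
  · rw [e1]; field_simp
  · rw [e2, Real.div_rpow hν.le hK0.le]
    have e3 : K = K ^ (((N : ℝ) + 1) / ((N : ℝ) + 3)) * K ^ (2 / ((N : ℝ) + 3)) := by
      rw [← Real.rpow_add hK0, ← add_div]
      rw [show (N : ℝ) + 1 + 2 = N + 3 by ring, div_self hN.ne', Real.rpow_one]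
    have hKp : K ^ (((N : ℝ) + 1) / ((N : ℝ) + 3)) ≠ 0 := (Real.rpow_pos_of_pos hK0 _).ne'
    nth_rw 1 [e3]
    field_simp

/-- Once each mode with frequency `K = 2π|k|` decays at the rate `ν ^ θ K ^ (2 / (N + 3))`, the
Gevrey weight is absorbed by the decay between the times `t₀ ≤ t / 2` and `t`. -/
theorem IsSolution.gevreyNorm_le {b : ℝ → ℝ} {N : ℕ} {C r : ℝ} (hC : 0 < C)
    (hr : 0 < r)
    (hres : ∀ (bc : BoundaryCondition) (κ ν δ : ℝ), κ ≠ 0 → 0 < δ → δ ≤ r →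
      ν = |κ| * δ ^ (N + 3) → ResolventBound bc b κ ν (C * (|κ| * δ ^ (N + 1))))
    {p ν : ℝ} (hp : ((N : ℝ) + 3) / 2 < p) (hν : 0 < ν) (hνr : ν < r ^ (N + 3))
    {bc : BoundaryCondition} {f_in : ℝ × ℝ → ℝ} {f : ℝ → ℝ × ℝ → ℝ}
    (hf : IsSolution bc b ν f_in f) {t₀ t : ℝ} (ht₀ : 0 < t₀) (ht : 2 * t₀ ≤ t) :
    gevreyNorm (C / 24 * ν ^ (((N : ℝ) + 1) / ((N : ℝ) + 3)) * t) p (f t) ≤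
      2 * eLpNorm (f t₀) 2 volΩ := by
  have hmode := fun k => hf.isModeSolution k
  have htpos : 0 < t := by linarith
  have hN : (0 : ℝ) < (N : ℝ) + 3 := by positivity
  have hp0 : 0 < p := lt_trans (by positivity) hp
  set a := C / 24 * ν ^ (((N : ℝ) + 1) / ((N : ℝ) + 3)) * t with ha
  have hk : ∀ k : ℤ, Real.exp (a * (2 * Real.pi * |(k : ℝ)|) ^ (1 / p)) ^ 2 *
      modeEnergy (xFourier (f t) k) ≤ Real.exp 1 * modeEnergy (xFourier (f t₀) k) := by
    intro k
    by_cases hk0 : k = 0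
    -- the mean in `x` carries no weight, since `0 ^ (1 / p) = 0`
    · have hanti := (hmode k).antitoneOn_modeEnergy hν.le
      have h1 := hanti (a := t₀) (b := t) ht₀ htpos (by linarith)
      have h2 := modeEnergy_nonneg (xFourier (f t₀) k)
      have h3 : (1 : ℝ) ≤ Real.exp 1 := Real.one_le_exp zero_le_one
      have h4 : modeEnergy (xFourier (f t) k) ≤ modeEnergy (xFourier (f t₀) k) := h1
      have e : (2 * Real.pi * |(k : ℝ)|) ^ (1 / p) = 0 := by
        rw [hk0, Int.cast_zero, abs_zero, mul_zero, Real.zero_rpow (by positivity)]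
      rw [e, mul_zero, Real.exp_zero, one_pow, one_mul]
      nlinarith
    · have hκ : 2 * Real.pi * (k : ℝ) ≠ 0 := by
        have : (k : ℝ) ≠ 0 := by exact_mod_cast hk0
        positivity
      have habs : |2 * Real.pi * (k : ℝ)| = 2 * Real.pi * |(k : ℝ)| := by
        rw [abs_mul, abs_of_pos (by positivity : (0 : ℝ) < 2 * Real.pi)]
      have hk1 : (1 : ℝ) ≤ |(k : ℝ)| := by
        rw [← Int.cast_abs]
        exact_mod_cast Int.one_le_abs hk0
      have hK1 : 1 ≤ |2 * Real.pi * (k : ℝ)| := by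
        rw [habs]
        nlinarith [Real.pi_gt_three]
      set K := |2 * Real.pi * (k : ℝ)| with hKdef
      obtain ⟨δ, hδ, hδr, hνδ, hrate⟩ := exists_balance_scale N hν hK1 hr hνr
      have hΨ : 0 < C * (K * δ ^ (N + 1)) := by positivity
      have hdec := (hmode k).modeEnergy_le_exp hν.le (t := t) ht₀ (by linarith) hΨ
        (hres bc _ ν δ hκ hδ hδr hνδ)
      have hdec' : modeEnergy (xFourier (f t) k) ≤
          Real.exp (1 - C * (K * δ ^ (N + 1)) / 6 * (t - t₀)) *
            modeEnergy (xFourier (f t₀) k) := hdec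
      rw [← habs]
      have hpow : K ^ (1 / p) ≤ K ^ (2 / ((N : ℝ) + 3)) := by
        refine Real.rpow_le_rpow_of_exponent_le hK1 ?_
        rw [div_le_div_iff₀ hp0 hN]
        linarith
      have hexp : 2 * (a * K ^ (1 / p)) ≤ C * (K * δ ^ (N + 1)) / 6 * (t - t₀) := by
        calc 2 * (a * K ^ (1 / p)) ≤ 2 * (a * K ^ (2 / ((N : ℝ) + 3))) := by gcongr
          _ = C * (K * δ ^ (N + 1)) / 6 * (t / 2) := by rw [hrate, ha]; ring
          _ ≤ C * (K * δ ^ (N + 1)) / 6 * (t - t₀) := by gcongr; linarith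
      have hE := modeEnergy_nonneg (xFourier (f t₀) k)
      calc Real.exp (a * K ^ (1 / p)) ^ 2 * modeEnergy (xFourier (f t) k)
          ≤ Real.exp (a * K ^ (1 / p)) ^ 2 *
            (Real.exp (1 - C * (K * δ ^ (N + 1)) / 6 * (t - t₀)) *
              modeEnergy (xFourier (f t₀) k)) := by gcongr
        _ = Real.exp (2 * (a * K ^ (1 / p)) + (1 - C * (K * δ ^ (N + 1)) / 6 * (t - t₀))) *
              modeEnergy (xFourier (f t₀) k) := by
            rw [← mul_assoc, ← Real.exp_nat_mul, ← Real.exp_add]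
            norm_num
        _ ≤ Real.exp 1 * modeEnergy (xFourier (f t₀) k) := by
            gcongr
            linarith
  have hcont : ∀ k : ℤ, ContinuousOn (xFourier (f t) k) (Icc 0 1) := fun k =>
    (hmode k).cont.slice_left htpos
  have hcont₀ : ContinuousOn (f t₀) (Icc 0 1 ×ˢ Icc 0 1) :=
    (hf.smooth.continuousOn.slice_left ht₀).mono
      (prod_mono (subset_univ _) bc.crossSection.Icc_subset_closed)
  have hexp4 : Real.exp 1 ≤ 4 := by linarith [Real.exp_one_lt_d9]
  rw [gevreyNorm_eq hcont]
  calc (∑' k : ℤ, ENNReal.ofReal (Real.exp (a * (2 * Real.pi * |(k : ℝ)|) ^ (1 / p)) ^ 2 *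
          modeEnergy (xFourier (f t) k))) ^ (1 / 2 : ℝ)
      ≤ (∑' k : ℤ, 4 * ENNReal.ofReal (modeEnergy (xFourier (f t₀) k))) ^ (1 / 2 : ℝ) := by
        refine ENNReal.rpow_le_rpow (ENNReal.tsum_le_tsum fun k => ?_) (by norm_num)
        have e4 : (4 : ℝ≥0∞) = ENNReal.ofReal 4 := by norm_num
        rw [e4, ← ENNReal.ofReal_mul (by norm_num)]
        exact ENNReal.ofReal_le_ofReal ((hk k).trans
          (mul_le_mul_of_nonneg_right hexp4 (modeEnergy_nonneg _)))
    _ = ((2 * eLpNorm (f t₀) 2 volΩ) ^ 2) ^ (1 / 2 : ℝ) := by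
        rw [ENNReal.tsum_mul_left, tsum_modeEnergy_xFourier hcont₀, mul_pow]
        norm_num
    _ = 2 * eLpNorm (f t₀) 2 volΩ := by
        rw [← ENNReal.rpow_natCast, ← ENNReal.rpow_mul]
        norm_num

theorem aestronglyMeasurable_volΩ {g : ℝ × ℝ → ℝ} {D : CrossSection}
    (hg : ContinuousOn g (univ ×ˢ D.closed)) : AEStronglyMeasurable g volΩ :=
  (hg.mono (prod_mono (subset_univ _)
    (Ioo_subset_Icc_self.trans D.Icc_subset_closed))).aestronglyMeasurable
      (measurableSet_Ioo.prod measurableSet_Ioo)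

theorem ae_mem_volΩ : ∀ᵐ z ∂volΩ, z ∈ Ioo (0 : ℝ) 1 ×ˢ Ioo (0 : ℝ) 1 :=
  ae_restrict_mem (measurableSet_Ioo.prod measurableSet_Ioo)

theorem IsSolution.ae_eq_initial {bc : BoundaryCondition} {b : ℝ → ℝ} {ν : ℝ}
    {f_in : ℝ × ℝ → ℝ} {f : ℝ → ℝ × ℝ → ℝ} (hf : IsSolution bc b ν f_in f) :
    f 0 =ᵐ[volΩ] f_in := by
  filter_upwards [ae_mem_volΩ] with z hz
  exact hf.initial z.1 z.2 (bc.crossSection.Icc_subset_closed (Ioo_subset_Icc_self hz.2))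

theorem IsInitialDatum.eLpNorm_lt_top {bc : BoundaryCondition} {f_in : ℝ × ℝ → ℝ}
    (hin : IsInitialDatum bc f_in) : eLpNorm f_in 2 volΩ < ⊤ := by
  have hc := hin.smooth.continuousOn
  have hc' : ContinuousOn f_in (Icc 0 1 ×ˢ Icc 0 1) :=
    hc.mono (prod_mono (subset_univ _) bc.crossSection.Icc_subset_closed)
  obtain ⟨M, hM⟩ := (isCompact_Icc.prod isCompact_Icc).exists_bound_of_continuousOn hc'
  refine (MemLp.of_bound (aestronglyMeasurable_volΩ hc) M ?_).eLpNorm_lt_top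
  filter_upwards [ae_mem_volΩ] with z hz
  exact hM z ⟨Ioo_subset_Icc_self hz.1, Ioo_subset_Icc_self hz.2⟩

/-- A bound by the `L²` norm at all small positive times passes to the initial time. -/
theorem IsSolution.le_of_forall_le {bc : BoundaryCondition} {b : ℝ → ℝ} {ν : ℝ}
    {f_in : ℝ × ℝ → ℝ} {f : ℝ → ℝ × ℝ → ℝ} (hf : IsSolution bc b ν f_in f)
    (hin : IsInitialDatum bc f_in) {A : ℝ≥0∞} {t : ℝ} (ht : 0 < t)
    (h : ∀ t₀, 0 < t₀ → 2 * t₀ ≤ t → A ≤ 2 * eLpNorm (f t₀) 2 volΩ) :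
    A ≤ 2 * eLpNorm f_in 2 volΩ := by
  have hlim := (hf.continuous_L2 0 le_rfl).mono_left (nhdsWithin_mono 0 Ioi_subset_Ici_self)
  have hlim2 : Tendsto (fun s => 2 * (eLpNorm (f s - f 0) 2 volΩ + eLpNorm f_in 2 volΩ))
      (𝓝[>] 0) (𝓝 (2 * (0 + eLpNorm f_in 2 volΩ))) :=
    ENNReal.Tendsto.const_mul (hlim.add tendsto_const_nhds) (Or.inr (by norm_num))
  rw [zero_add] at hlim2
  refine ge_of_tendsto hlim2 ?_
  have hm0 : AEStronglyMeasurable (f 0) volΩ :=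
    (aestronglyMeasurable_volΩ hin.smooth.continuousOn).congr hf.ae_eq_initial.symm
  filter_upwards [Ioc_mem_nhdsGT (half_pos ht)] with s hs
  refine (h s hs.1 (by linarith [hs.2])).trans ?_
  have hms : AEStronglyMeasurable (f s) volΩ :=
    aestronglyMeasurable_volΩ (hf.smooth.continuousOn.slice_left hs.1)
  have := eLpNorm_add_le (hms.sub hm0) hm0 (p := 2) (by norm_num)
  rw [sub_add_cancel, eLpNorm_congr_ae hf.ae_eq_initial] at this
  gcongr

end ShearFlow

theorem theorem2 (D : ShearFlow.CrossSection) (b : ℝ → ℝ) (N : ℕ)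
    (hb : ShearFlow.IsShearProfile D b N) :
    ∃ d₀ ν₀ : ℝ, 0 < d₀ ∧ 0 < ν₀ ∧
      ∀ p : ℝ, ((N : ℝ) + 3) / 2 < p →
        ∃ C : ℝ≥0, ∀ ν : ℝ, 0 < ν → ν < ν₀ →
          ∀ bc : ShearFlow.BoundaryCondition, bc.crossSection = D →
            ∀ (f_in : ℝ × ℝ → ℝ) (f : ℝ → ℝ × ℝ → ℝ),
              ShearFlow.IsInitialDatum bc f_in →
              ShearFlow.IsSolution bc b ν f_in f →
                ∀ t : ℝ, 0 < t →
                  ShearFlow.GevreyInX p (f t) ∧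
                  ShearFlow.gevreyNorm (d₀ * ν ^ (((N : ℝ) + 1) / ((N : ℝ) + 3)) * t) p (f t)
                    ≤ C * eLpNorm f_in 2 ShearFlow.volΩ := by
  obtain ⟨c, r, hc, hr, hr1, hnd⟩ := hb.exists_nondegenerate
  obtain ⟨C, hC, hres⟩ := hnd.resolvent_estimate hc hr1
  refine ⟨C / 24, r ^ (N + 3), by positivity, by positivity, fun p hp => ⟨2, ?_⟩⟩
  intro ν hν hνr bc _ f_in f hin hf t ht
  have hbound : ShearFlow.gevreyNorm
      (C / 24 * ν ^ (((N : ℝ) + 1) / ((N : ℝ) + 3)) * t) p (f t) ≤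
        2 * eLpNorm f_in 2 ShearFlow.volΩ :=
    hf.le_of_forall_le hin ht fun t₀ h0 h1 => hf.gevreyNorm_le hC hr hres hp hν hνr h0 h1
  refine ⟨⟨_, by positivity, hbound.trans_lt ?_⟩, by simpa using hbound⟩
  exact ENNReal.mul_lt_top (by norm_num) hin.eLpNorm_lt_top
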